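/- Consider the problem $$u_{tt}-u_{xx}+Ku+\lambda u_t=f(x,t)\quad\text{in }(0,1)\times(0,\infty),$$ $$u_x(0,t)=h_0u(0,t)+\lambda_0u_t(0,t)+\widetilde h_1u(1,t)+\widetilde\lambda_1u_t(1,t)+g_0(t),$$ $$-u_x(1,t)=h_1u(1,t)+\lambda_1u_t(1,t)+\widetilde h_0u(0,t)+\widetilde\lambda_0u_t(0,t)+g_1(t),$$ $$u(x,0)=\widetilde u_0(x),\qquad u_t(x,0)=\widetilde u_1(x),$$ with real constants such that $h_0,\lambda_0,\lambda_1>0$, $h_1\ge 0$, $K>0$, $\lambda>0$ and $|\widetilde\lambda_0+\widetilde\lambda_1|<2\sqrt{\lambda_0\lambda_1}$. Write $\|\cdot\|$ for the norm of $L^2(0,1)$, $\|v\|_a^2=\|v_x\|^2+h_0v(0)^2+h_1v(1)^2$ for $v\in H^1(0,1)$, and $$E(t)=\tfrac12\|u_t(t)\|^2+\tfrac12\|u(t)\|_a^2+\tfrac K2\|u(t)\|^2 .$$ A strong solution is a function $u$ such that, for every $T>0$, $u\in C^0([0,T];H^1(0,1))\cap C^1([0,T];L^2(0,1))\cap L^\infty(0,T;H^2(0,1))$,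 $u_t\in L^\infty(0,T;H^1(0,1))$, $u_{tt}\in L^\infty(0,T;L^2(0,1))$ and $u(0,\cdot),u(1,\cdot)\in H^2(0,T)$, and which satisfies the equation and the boundary conditions for almost all $t>0$, and the initial conditions. Theorem. There is $\eta>0$, depending only on $h_0,h_1,\lambda_0,\lambda_1,\widetilde\lambda_0,\widetilde\lambda_1,K,\lambda$, such that the following holds whenever $|\widetilde h_0|\le\eta$ and $|\widetilde h_1|\le\eta$. For every $\sigma_2>0$ there is $\gamma_2>0$, and for all $\sigma_1>0$ and $M\in\mathbb R$ there is $\gamma_1>0$, such that, if $$\|f(t)\|^2+g_0(t)^2+g_1(t)^2\le\sigma_1e^{-\sigma_2t}\quad\text{for all }t\ge0,$$ then every strong solution $u$ with $E(0)\le M$ satisfies $E(t)\le\gamma_1e^{-\gamma_2t}$ for all $t\ge0$. Here $\gamma_2$ depends only on the constants of the problem and on $\sigma_2$, and $\gamma_1$ only on these, $\sigma_1$ and $M$. -/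

import Mathlib

open MeasureTheory Set
open scoped ContDiff

noncomputable section

namespace WaveDecay

/-- `w` is the weak derivative of `v` on the interval `(a, b)`: both functions are locally
integrable there, and `∫ φ' v = - ∫ φ w` for every test function `φ ∈ C_c^∞(a, b)`.
The functions take values in a normed space, so that this covers real functions of `x ∈ (0,1)` or of
`t ∈ (0,T)` as well as functions of `t` with values in `L²(0,1)`. -/
def HasWeakDeriv {E : Type*} [NormedAddCommGroup E] [NormedSpace ℝ E]
    (a b : ℝ) (v w : ℝ → E) : Prop :=
  LocallyIntegrableOn v (Ioo a b) ∧ LocallyIntegrableOn w (Ioo a b) ∧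
    ∀ φ : ℝ → ℝ, ContDiff ℝ ∞ φ → HasCompactSupport φ → tsupport φ ⊆ Ioo a b →
      ∫ x in Ioo a b, deriv φ x • v x = -∫ x in Ioo a b, φ x • w x

/-- The Hilbert space `L²(0,1)`. -/
abbrev L2 : Type := Lp ℝ 2 (volume.restrict (Ioo (0 : ℝ) 1))

theorem integrable_coe (v : L2) : Integrable v (volume.restrict (Ioo (0 : ℝ) 1)) :=
  (Lp.memLp v).integrable (by norm_num)

theorem locallyIntegrableOn_coe (v : L2) : LocallyIntegrableOn v (Ioo (0 : ℝ) 1) :=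
  IntegrableOn.locallyIntegrableOn (integrable_coe v)

theorem integrable_test_smul {φ : ℝ → ℝ} (hφ : Continuous φ) (hc : HasCompactSupport φ)
    (v : L2) : Integrable (fun x => φ x • v x) (volume.restrict (Ioo (0 : ℝ) 1)) := by
  obtain ⟨C, hC⟩ := hc.exists_bound_of_continuous hφ
  exact (integrable_coe v).bdd_mul hφ.aestronglyMeasurable (Filter.Eventually.of_forall hC)

theorem integral_test_add {φ : ℝ → ℝ} (hφ : Continuous φ) (hc : HasCompactSupport φ)
    (v v' : L2) :
    ∫ x in Ioo (0 : ℝ) 1, φ x • (v + v' : L2) x =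
      (∫ x in Ioo (0 : ℝ) 1, φ x • v x) + ∫ x in Ioo (0 : ℝ) 1, φ x • v' x := by
  rw [← integral_add (integrable_test_smul hφ hc v) (integrable_test_smul hφ hc v')]
  refine integral_congr_ae ?_
  filter_upwards [Lp.coeFn_add v v'] with x hx
  rw [hx, Pi.add_apply, smul_add]

theorem integral_test_smul (φ : ℝ → ℝ) (c : ℝ) (v : L2) :
    ∫ x in Ioo (0 : ℝ) 1, φ x • (c • v : L2) x = c * ∫ x in Ioo (0 : ℝ) 1, φ x • v x := by
  rw [← integral_const_mul]
  refine integral_congr_ae ?_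
  filter_upwards [Lp.coeFn_smul c v] with x hx
  rw [hx, Pi.smul_apply, smul_eq_mul, smul_eq_mul, smul_eq_mul]
  ring

theorem HasWeakDeriv.add {v w v' w' : L2} (h : HasWeakDeriv 0 1 v w)
    (h' : HasWeakDeriv 0 1 v' w') :
    HasWeakDeriv 0 1 (v + v' : L2) (w + w' : L2) := by
  refine ⟨locallyIntegrableOn_coe _, locallyIntegrableOn_coe _, fun φ hφ hc hs => ?_⟩
  rw [integral_test_add (hφ.continuous_deriv (by simp)) hc.deriv,
    integral_test_add hφ.continuous hc, h.2.2 φ hφ hc hs, h'.2.2 φ hφ hc hs]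
  ring

theorem HasWeakDeriv.smul (c : ℝ) {v w : L2} (h : HasWeakDeriv 0 1 v w) :
    HasWeakDeriv 0 1 (c • v : L2) (c • w : L2) := by
  refine ⟨locallyIntegrableOn_coe _, locallyIntegrableOn_coe _, fun φ hφ hc hs => ?_⟩
  rw [integral_test_smul, integral_test_smul, h.2.2 φ hφ hc hs]
  ring

theorem HasWeakDeriv.zero : HasWeakDeriv 0 1 (0 : L2) (0 : L2) := by
  refine ⟨locallyIntegrableOn_coe _, locallyIntegrableOn_coe _, fun φ _ _ _ => ?_⟩
  have key : ∀ ψ : ℝ → ℝ, ∫ x in Ioo (0 : ℝ) 1, ψ x • (0 : L2) x = 0 := fun ψ => by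
    have := integral_test_smul ψ 0 (0 : L2)
    rwa [zero_smul, zero_mul] at this
  rw [key, key, neg_zero]

/-- The Sobolev space `H¹(0,1)` as a subspace: the pairs `(v, v_x)` in `L²(0,1) × L²(0,1)` in which `v_x` is the
weak derivative of `v`, with the norm `(‖v‖² + ‖v_x‖²)^{1/2}`. -/
def H1Space : Submodule ℝ (WithLp 2 (L2 × L2)) where
  carrier := {p | HasWeakDeriv 0 1 p.fst p.snd}
  add_mem' h h' := HasWeakDeriv.add h h'
  zero_mem' := HasWeakDeriv.zero
  smul_mem' c _ h := HasWeakDeriv.smul c h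

/-- The Sobolev space `H¹(0,1)` as a normed space. -/
abbrev H1 : Type := H1Space

/-- The function `v ∈ L²(0,1)` underlying an element of `H¹(0,1)`. -/
def H1.toL2 (v : H1) : L2 := v.1.fst

/-- The weak derivative `v_x ∈ L²(0,1)` of `v ∈ H¹(0,1)`. -/
def H1.dx (v : H1) : L2 := v.1.snd

/-- The Sobolev space `H²(0,1)` as a subspace: the pairs `(v, v_x)` in `L²(0,1) × H¹(0,1)` in which `v_x` is the
weak derivative of `v`, with the norm `(‖v‖² + ‖v_x‖² + ‖v_xx‖²)^{1/2}`. -/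
def H2Space : Submodule ℝ (WithLp 2 (L2 × H1)) where
  carrier := {p | HasWeakDeriv 0 1 p.fst (H1.toL2 p.snd)}
  add_mem' h h' := HasWeakDeriv.add h h'
  zero_mem' := HasWeakDeriv.zero
  smul_mem' c _ h := HasWeakDeriv.smul c h

/-- The Sobolev space `H²(0,1)` as a normed space. -/
abbrev H2 : Type := H2Space

/-- The derivative `v_x ∈ H¹(0,1)` of `v ∈ H²(0,1)`. -/
def H2.dx (v : H2) : H1 := v.1.snd

/-- The inclusion of `H²(0,1)` in `H¹(0,1)`. -/
def H2.toH1 (v : H2) : H1 := ⟨WithLp.toLp 2 (v.1.fst, v.1.snd.toL2), v.2⟩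

open Classical in
/-- The continuous representative on `[0,1]` of an element of `L²(0,1)`, if there is one (as is the
case for every element of `H¹(0,1)`); its values on `[0,1]` are unique. -/
def contRep (v : L2) : ℝ → ℝ :=
  if h : ∃ c : ℝ → ℝ, ContinuousOn c (Icc 0 1) ∧ v =ᵐ[volume.restrict (Ioo (0 : ℝ) 1)] c
  then h.choose else 0

/-- The value `v(x)` of `v ∈ H¹(0,1) ⊂ C⁰([0,1])` at a point `x ∈ [0,1]`. -/
def H1.eval (v : H1) (x : ℝ) : ℝ := contRep v.toL2 x

/-- `v ∈ L^∞(0,T;X)` for every `T > 0`. -/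
def MemLinftyLoc {X : Type*} [NormedAddCommGroup X] (v : ℝ → X) : Prop :=
  ∀ T : ℝ, 0 < T → MemLp v ⊤ (volume.restrict (Ioo 0 T))

/-- The real function `v` belongs to the Sobolev space `H²(0,T)`. -/
def MemH2Time (T : ℝ) (v : ℝ → ℝ) : Prop :=
  ∃ v' v'' : ℝ → ℝ,
    MemLp v 2 (volume.restrict (Ioo 0 T)) ∧ MemLp v' 2 (volume.restrict (Ioo 0 T)) ∧
    MemLp v'' 2 (volume.restrict (Ioo 0 T)) ∧
    HasWeakDeriv 0 T v v' ∧ HasWeakDeriv 0 T v' v''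

/-- The bilinear form `a(v,w) = ⟨v_x, w_x⟩ + h₀ v(0) w(0) + h₁ v(1) w(1)` on `H¹(0,1)`. -/
def aForm (h0 h1 : ℝ) (v w : H1) : ℝ :=
  inner ℝ v.dx w.dx + h0 * v.eval 0 * w.eval 0 + h1 * v.eval 1 * w.eval 1

/-- The norm `‖v‖_a = a(v,v)^{1/2}`. -/
def aNorm (h0 h1 : ℝ) (v : H1) : ℝ := Real.sqrt (aForm h0 h1 v v)

/-- The time derivative `u_t(t) ∈ L²(0,1)`, for `t ≥ 0`, of `u : [0,∞) → H¹(0,1) ⊂ L²(0,1)`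
(one-sided at `t = 0`). -/
def timeDeriv (u : ℝ → H1) (t : ℝ) : L2 := derivWithin (fun s => (u s).toL2) (Ici 0) t

/-- The energy `E(t) = ½ ‖u_t(t)‖² + ½ ‖u(t)‖_a² + (K/2) ‖u(t)‖²`. -/
def energy (h0 h1 K : ℝ) (u : ℝ → H1) (t : ℝ) : ℝ :=
  1 / 2 * ‖timeDeriv u t‖ ^ 2 + 1 / 2 * aNorm h0 h1 (u t) ^ 2 + K / 2 * ‖(u t).toL2‖ ^ 2

/-- The constants in the equation and in the boundary conditions. -/
structure Coeffs where
  (h0 h1 lam0 lam1 : ℝ)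
  /-- The coupling coefficients of the displacements, with tilde in print. -/
  (ht0 ht1 : ℝ)
  /-- The coupling coefficients of the velocities, with tilde in print. -/
  (lamt0 lamt1 : ℝ)
  (K lam : ℝ)

/-- `u : [0,∞) → H¹(0,1)` is a strong solution of the problem
* `u_tt - u_xx + K u + λ u_t = f` in `(0,1) × (0,∞)`,
* `u_x(0,t) = h₀ u(0,t) + λ₀ u_t(0,t) + h̃₁ u(1,t) + λ̃₁ u_t(1,t) + g₀(t)`,
* `-u_x(1,t) = h₁ u(1,t) + λ₁ u_t(1,t) + h̃₀ u(0,t) + λ̃₀ u_t(0,t) + g₁(t)`,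
* `u(0) = u₀`, `u_t(0) = u₁`.

The values of `u`, `f`, `g₀`, `g₁` at negative times play no role. -/
structure IsStrongSolution (c : Coeffs) (f : ℝ → L2) (g0 g1 : ℝ → ℝ) (u0 : H1) (u1 : L2)
    (u : ℝ → H1) : Prop where
  /-- `u ∈ C⁰([0,T];H¹)` for all `T > 0`. -/
  continuousOn : ContinuousOn u (Ici 0)
  /-- `u ∈ C¹([0,T];L²)` for all `T > 0`. -/
  contDiffOn : ContDiffOn ℝ 1 (fun t => (u t).toL2) (Ici 0)
  /-- `u(0,·) ∈ H²(0,T)` for all `T > 0`. -/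
  trace_zero : ∀ T : ℝ, 0 < T → MemH2Time T (fun t => (u t).eval 0)
  /-- `u(1,·) ∈ H²(0,T)` for all `T > 0`. -/
  trace_one : ∀ T : ℝ, 0 < T → MemH2Time T (fun t => (u t).eval 1)
  /-- `u ∈ L^∞(0,T;H²)`, `u_t ∈ L^∞(0,T;H¹)` and `u_tt ∈ L^∞(0,T;L²)` for all `T > 0`; here `U` is
  `u` as a function with values in `H²`, `V` is `u_t` as a function with values in `H¹`, and `W` is
  `u_tt`. With these, the equation and the boundary conditions hold for almost all `t > 0`. -/
  equations : ∃ (U : ℝ → H2) (V : ℝ → H1) (W : ℝ → L2),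
    MemLinftyLoc U ∧ MemLinftyLoc V ∧ MemLinftyLoc W ∧
    (∀ᵐ t ∂volume.restrict (Ioi (0 : ℝ)), (U t).toH1 = u t) ∧
    (∀ᵐ t ∂volume.restrict (Ioi (0 : ℝ)), (V t).toL2 = timeDeriv u t) ∧
    (∀ T : ℝ, 0 < T → HasWeakDeriv 0 T (timeDeriv u) W) ∧
    (∀ᵐ t ∂volume.restrict (Ioi (0 : ℝ)),
      W t - (U t).dx.dx + c.K • (u t).toL2 + c.lam • timeDeriv u t = f t) ∧
    (∀ᵐ t ∂volume.restrict (Ioi (0 : ℝ)),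
      (U t).dx.eval 0 = c.h0 * (u t).eval 0 + c.lam0 * (V t).eval 0
        + c.ht1 * (u t).eval 1 + c.lamt1 * (V t).eval 1 + g0 t) ∧
    (∀ᵐ t ∂volume.restrict (Ioi (0 : ℝ)),
      -(U t).dx.eval 1 = c.h1 * (u t).eval 1 + c.lam1 * (V t).eval 1
        + c.ht0 * (u t).eval 0 + c.lamt0 * (V t).eval 0 + g1 t)
  /-- `u(·,0) = u₀`. -/
  initial_position : u 0 = u0
  /-- `u_t(·,0) = u₁`. -/
  initial_velocity : timeDeriv u 0 = u1

end WaveDecay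

end

/-!
The proof perturbs the energy to `G = E + ε ⟨u, u_t⟩`. Multiplying the equation by `u_t` and by
`u` and integrating by parts in `x` expresses `G'` through the damping `-λ ‖u_t‖²`, the boundary
terms, the restoring terms `-ε (‖u‖_a² + K ‖u‖²)` and the data (`perturbedEnergy_deriv_eq`). The
condition on `λ̃₀ + λ̃₁` makes the boundary damping a coercive quadratic form in `(u_t(0,t),
u_t(1,t))`, and `0 < h₀` bounds the traces of `u` by `‖u‖_a`. So for `ε` small, and then `h̃₀`,
`h̃₁` small depending on `ε`, Young's inequality gives `G' ≤ -κ E + C (‖f‖² + g₀² + g₁²)`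
(`exists_dissipation`). As `G` is equivalent to `E`, a Gronwall argument
(`exp_decay_of_ae_deriv_le`) yields the decay.

The multiplier computation holds for almost every `t` only, and so `G` has to be absolutely
continuous. This rests on two facts: `u` is a primitive of `u_t` in `H¹(0,1)`, because `H¹(0,1)`
is complete and embeds in `L²(0,1)`, where `u` is of class `C¹`; and `u_t` is a primitive of its
weak derivative `u_tt` in `L²(0,1)`, by the lemma of du Bois-Reymond for vector-valued functions
(`HasWeakDeriv.ae_eq_primitive`). The same lemma in the variable `x` provides the traces of
functions in `H¹(0,1)` as continuous functionals and the integration by parts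
(`H1.inner_dx_toL2`).
-/

noncomputable section

open Filter

namespace WaveDecay

/-! ### Absolutely continuous functions with values in normed spaces -/

section AbsolutelyContinuous

variable {X Y Z E : Type*} [PseudoMetricSpace X] [PseudoMetricSpace Y] [PseudoMetricSpace Z]
  [NormedAddCommGroup E] [NormedSpace ℝ E]

/-- Comparison principle for absolute continuity: a function whose increments are controlled by those
of two absolutely continuous functions is absolutely continuous. -/
theorem absolutelyContinuous_of_dist_le {f : ℝ → X} {g : ℝ → Y} {h : ℝ → Z} {a b : ℝ}
    (hf : AbsolutelyContinuousOnInterval f a b) (hg : AbsolutelyContinuousOnInterval g a b)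
    (C : ℝ) (H : ∀ x ∈ uIcc a b, ∀ y ∈ uIcc a b,
      dist (h x) (h y) ≤ C * (dist (f x) (f y) + dist (g x) (g y))) :
    AbsolutelyContinuousOnInterval h a b := by
  unfold AbsolutelyContinuousOnInterval at hf hg ⊢
  have key := (hf.add hg).const_mul C
  rw [add_zero, mul_zero] at key
  refine squeeze_zero' (Eventually.of_forall fun _ => Finset.sum_nonneg fun _ _ => dist_nonneg)
    ?_ key
  filter_upwards [mem_inf_of_right (mem_principal_self _)] with I hI
  rw [← Finset.sum_add_distrib, Finset.mul_sum]
  exact Finset.sum_le_sum fun i hi => H _ (hI.1 i hi).1 _ (hI.1 i hi).2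

theorem absolutelyContinuous_clm {F : Type*} [NormedAddCommGroup F] [NormedSpace ℝ F]
    (L : E →L[ℝ] F) {f : ℝ → E} {a b : ℝ} (hf : AbsolutelyContinuousOnInterval f a b) :
    AbsolutelyContinuousOnInterval (fun t => L (f t)) a b := by
  refine absolutelyContinuous_of_dist_le hf hf ‖L‖ fun x _ y _ => ?_
  rw [dist_eq_norm, dist_eq_norm, ← map_sub]
  have := L.le_opNorm (f x - f y)
  have := mul_nonneg (norm_nonneg L) (norm_nonneg (f x - f y))
  linarith

theorem absolutelyContinuous_inner {F : Type*} [NormedAddCommGroup F] [InnerProductSpace ℝ F]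
    {f g : ℝ → F} {a b : ℝ} (hf : AbsolutelyContinuousOnInterval f a b)
    (hg : AbsolutelyContinuousOnInterval g a b) :
    AbsolutelyContinuousOnInterval (fun t => inner ℝ (f t) (g t)) a b := by
  obtain ⟨A, hA⟩ := hf.exists_bound
  obtain ⟨B, hB⟩ := hg.exists_bound
  refine absolutelyContinuous_of_dist_le hf hg (A + B) fun x hx y hy => ?_
  rw [dist_eq_norm, dist_eq_norm, dist_eq_norm]
  have e : inner ℝ (f x) (g x) - inner ℝ (f y) (g y)
      = inner ℝ (f x - f y) (g x) + inner ℝ (f y) (g x - g y) := by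
    rw [inner_sub_left, inner_sub_right]; ring
  rw [e]
  have h1 := norm_inner_le_norm (𝕜 := ℝ) (f x - f y) (g x)
  have h2 := norm_inner_le_norm (𝕜 := ℝ) (f y) (g x - g y)
  have h3 := norm_add_le (inner ℝ (f x - f y) (g x)) (inner ℝ (f y) (g x - g y))
  have n1 := norm_nonneg (f x - f y)
  have n2 := norm_nonneg (g x - g y)
  have A0 : 0 ≤ A := (norm_nonneg _).trans (hA x hx)
  have B0 : 0 ≤ B := (norm_nonneg _).trans (hB x hx)
  have h4 := mul_le_mul_of_nonneg_left (hB x hx) n1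
  have h5 := mul_le_mul_of_nonneg_right (hA y hy) n2
  nlinarith [mul_nonneg A0 n1, mul_nonneg B0 n2]

theorem absolutelyContinuous_primitive {w : ℝ → E} {a b : ℝ}
    (hw : IntervalIntegrable w volume a b) :
    AbsolutelyContinuousOnInterval (fun x => ∫ y in a..x, w y) a b := by
  have h := hw.norm.absolutelyContinuousOnInterval_intervalIntegral (c := a) left_mem_uIcc
  refine absolutelyContinuous_of_dist_le h h 1 fun x hx y hy => ?_
  have hax : IntervalIntegrable w volume a x :=
    hw.mono_set (uIcc_subset_uIcc left_mem_uIcc hx)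
  have hay : IntervalIntegrable w volume a y :=
    hw.mono_set (uIcc_subset_uIcc left_mem_uIcc hy)
  rw [dist_eq_norm, dist_eq_norm, intervalIntegral.integral_interval_sub_left hax hay,
    intervalIntegral.integral_interval_sub_left hax.norm hay.norm, Real.norm_eq_abs]
  have := intervalIntegral.norm_integral_le_abs_integral_norm (f := w) (a := y) (b := x)
    (μ := volume)
  have := abs_nonneg (∫ t in y..x, ‖w t‖)
  linarith

/-- The fundamental theorem of calculus for absolutely continuous functions with values in a Banach
space. Without the Radon-Nikodym property the derivative need not exist almost everywhere, so that
it is given together with its integrability. -/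
theorem integral_eq_sub_of_absolutelyContinuous [CompleteSpace E] {f f' : ℝ → E} {a b : ℝ}
    (hf : AbsolutelyContinuousOnInterval f a b)
    (hd : ∀ᵐ x, x ∈ uIcc a b → HasDerivAt f (f' x) x)
    (hf' : IntervalIntegrable f' volume a b) :
    ∫ x in a..b, f' x = f b - f a := by
  have hac : AbsolutelyContinuousOnInterval (fun x => f x - ∫ y in a..x, f' y) a b :=
    hf.fun_sub (absolutelyContinuous_primitive hf')
  obtain ⟨C, hC⟩ := hac.const_of_ae_hasDerivAt_zero (by
    filter_upwards [hd, hf'.ae_hasDerivAt_integral] with x h1 h2 hx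
    have := (h1 hx).fun_sub (h2 hx a left_mem_uIcc)
    rwa [sub_self] at this)
  have h1 := hC a left_mem_uIcc
  have h2 := hC b right_mem_uIcc
  rw [intervalIntegral.integral_same, sub_zero] at h1
  rw [h1, ← h2]
  abel

theorem le_of_absolutelyContinuous_of_deriv_nonpos {f f' : ℝ → ℝ} {a b : ℝ} (hab : a ≤ b)
    (hf : AbsolutelyContinuousOnInterval f a b)
    (hd : ∀ᵐ x, x ∈ Icc a b → HasDerivAt f (f' x) x ∧ f' x ≤ 0) : f b ≤ f a := by
  have h := hf.integral_deriv_eq_sub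
  have : ∫ x in a..b, deriv f x ≤ 0 := by
    rw [intervalIntegral.integral_of_le hab]
    refine integral_nonpos_of_ae ?_
    rw [EventuallyLE, ae_restrict_iff' measurableSet_Ioc]
    filter_upwards [hd] with x hx hx'
    have := hx (Ioc_subset_Icc_self hx')
    rw [this.1.deriv]
    exact this.2
  linarith

end AbsolutelyContinuous

/-! ### Functions of one variable with an integrable weak derivative -/

section WeakDerivative

variable {E : Type*} [NormedAddCommGroup E] [NormedSpace ℝ E]

theorem integrableOn_test_smul {a b : ℝ} {v : ℝ → E} (hv : LocallyIntegrableOn v (Ioo a b))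
    {φ : ℝ → ℝ} (hφ : Continuous φ) (hc : HasCompactSupport φ) (hs : tsupport φ ⊆ Ioo a b) :
    IntegrableOn (fun x => φ x • v x) (Ioo a b) := by
  have h1 : IntegrableOn v (tsupport φ) := hv.integrableOn_compact_subset hs hc
  obtain ⟨C, hC⟩ := hc.exists_bound_of_continuous hφ
  have h2 : IntegrableOn (fun x => φ x • v x) (tsupport φ) :=
    h1.bdd_smul C hφ.aestronglyMeasurable (Eventually.of_forall hC)
  refine ((integrableOn_iff_integrable_of_support_subset ?_).1 h2).integrableOn
  intro x hx
  refine subset_tsupport φ ?_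
  intro h0
  exact hx (by simp [h0])

/-- A test function of integral zero is the derivative of a test function. -/
theorem exists_test_primitive {a b : ℝ} {θ : ℝ → ℝ} {k : Set ℝ} (hk : IsCompact k)
    (hkn : k.Nonempty) (hkab : k ⊆ Ioo a b) (hθ : ContDiff ℝ ∞ θ) (hs : ∀ x ∉ k, θ x = 0)
    (h0 : ∫ x, θ x = 0) :
    ∃ φ : ℝ → ℝ, ContDiff ℝ ∞ φ ∧ HasCompactSupport φ ∧ tsupport φ ⊆ Ioo a b ∧ deriv φ = θ := by
  obtain ⟨α, hα⟩ := hk.exists_isLeast hkn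
  obtain ⟨β, hβ⟩ := hk.exists_isGreatest hkn
  have hz : ∀ x, x < α ∨ β < x → θ x = 0 := by
    intro x hx
    refine hs x fun hxk => ?_
    rcases hx with hx | hx
    · exact absurd (hα.2 hxk) (not_le.2 hx)
    · exact absurd (hβ.2 hxk) (not_le.2 hx)
  have hαβ : α ≤ β := hα.2 hβ.1
  have hd : ∀ x, HasDerivAt (fun x => ∫ y in α..x, θ y) (θ x) x := fun x =>
    (hθ.continuous).integral_hasStrictDerivAt α x |>.hasDerivAt
  have hdd : deriv (fun x => ∫ y in α..x, θ y) = θ := funext fun x => (hd x).deriv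
  have hint : ∀ p q, IntervalIntegrable θ volume p q := fun p q =>
    hθ.continuous.intervalIntegrable p q
  have hsupp : Function.support (fun x => ∫ y in α..x, θ y) ⊆ Icc α β := by
    intro x hx
    by_contra hcon
    refine hx ?_
    rcases lt_or_ge x α with h | h
    · change ∫ y in α..x, θ y = 0
      rw [intervalIntegral.integral_symm, intervalIntegral.integral_of_le h.le,
        integral_Ioc_eq_integral_Ioo,
        setIntegral_congr_fun (g := fun _ => (0 : ℝ)) measurableSet_Ioo
          (fun y hy => hz y (Or.inl hy.2))]
      simp
    · have h' : β < x := by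
        by_contra h2
        exact hcon ⟨h, not_lt.1 h2⟩
      change ∫ y in α..x, θ y = 0
      rw [intervalIntegral.integral_of_le h, ← integral_Icc_eq_integral_Ioc,
        setIntegral_eq_integral_of_forall_compl_eq_zero, h0]
      intro y hy
      refine hz y ?_
      by_contra hcon
      push Not at hcon
      exact hy ⟨hcon.1, hcon.2.trans h'.le⟩
  have hts : tsupport (fun x => ∫ y in α..x, θ y) ⊆ Icc α β :=
    closure_minimal hsupp isClosed_Icc
  refine ⟨fun x => ∫ y in α..x, θ y, ?_, ?_, ?_, hdd⟩
  · rw [contDiff_infty_iff_deriv, hdd]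
    exact ⟨fun x => (hd x).differentiableAt, hθ⟩
  · exact HasCompactSupport.of_support_subset_isCompact isCompact_Icc hsupp
  · exact hts.trans (Icc_subset_Ioo (hkab hα.1).1 (hkab hβ.1).2)

/-- The lemma of du Bois-Reymond: a function with weak derivative zero is almost everywhere constant.
The constant is its mean against a fixed bump function `ψ₀` of integral one, since
`ψ - (∫ ψ) ψ₀` is the derivative of a test function for every test function `ψ`. -/
theorem ae_const_of_integral_deriv_smul_eq_zero [CompleteSpace E] {a b : ℝ} (hab : a < b)
    {z : ℝ → E}
    (hz : LocallyIntegrableOn z (Ioo a b))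
    (h : ∀ φ : ℝ → ℝ, ContDiff ℝ ∞ φ → HasCompactSupport φ → tsupport φ ⊆ Ioo a b →
      ∫ x in Ioo a b, deriv φ x • z x = 0) :
    ∃ c : E, ∀ᵐ x, x ∈ Ioo a b → z x = c := by
  let B : ContDiffBump ((a + b) / 2) :=
    ⟨(b - a) / 8, (b - a) / 4, by linarith, by linarith⟩
  set ψ₀ : ℝ → ℝ := B.normed volume with hψ₀
  have hψ₀d : ContDiff ℝ ∞ ψ₀ := B.contDiff_normed
  have hψ₀c : HasCompactSupport ψ₀ := B.hasCompactSupport_normed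
  have hψ₀i : ∫ x, ψ₀ x = 1 := B.integral_normed
  have hψ₀s : tsupport ψ₀ = Metric.closedBall ((a + b) / 2) ((b - a) / 4) :=
    B.tsupport_normed_eq
  have hψ₀ab : tsupport ψ₀ ⊆ Ioo a b := by
    rw [hψ₀s, Real.closedBall_eq_Icc]
    exact Icc_subset_Ioo (by linarith) (by linarith)
  have hne : (tsupport ψ₀).Nonempty := by
    rw [hψ₀s]
    exact Metric.nonempty_closedBall.2 (by linarith)
  refine ⟨∫ x in Ioo a b, ψ₀ x • z x, ?_⟩
  set c := ∫ x in Ioo a b, ψ₀ x • z x with hc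
  have key := isOpen_Ioo.ae_eq_zero_of_integral_contDiff_smul_eq_zero (μ := volume) (U := Ioo a b)
    (f := fun x => z x - c) (hz.sub (locallyIntegrableOn_const _)) ?_
  · filter_upwards [key] with x hx hx'
    exact sub_eq_zero.1 (hx hx')
  intro ψ hψd hψc hψs
  have hcont : ∀ x ∉ Ioo a b, ψ x • (z x - c) = 0 := by
    intro x hx
    rw [image_eq_zero_of_notMem_tsupport (fun h => hx (hψs h)), zero_smul]
  rw [← setIntegral_eq_integral_of_forall_compl_eq_zero hcont]
  have i1 := integrableOn_test_smul hz hψd.continuous hψc hψs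
  have i0 := integrableOn_test_smul hz hψ₀d.continuous hψ₀c hψ₀ab
  have i2 : Integrable ψ := hψd.continuous.integrable_of_hasCompactSupport hψc
  have i3 : Integrable ψ₀ := hψ₀d.continuous.integrable_of_hasCompactSupport hψ₀c
  set m := ∫ x, ψ x with hm
  obtain ⟨φ, hφ1, hφ2, hφ3, hφ4⟩ := exists_test_primitive (a := a) (b := b)
    (θ := fun x => ψ x - m * ψ₀ x) (k := tsupport ψ ∪ tsupport ψ₀)
    (hψc.isCompact.union hψ₀c.isCompact) (hne.mono subset_union_right)
    (union_subset hψs hψ₀ab) (hψd.sub (contDiff_const.mul hψ₀d)) (by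
      intro x hx
      rw [mem_union, not_or] at hx
      rw [image_eq_zero_of_notMem_tsupport hx.1, image_eq_zero_of_notMem_tsupport hx.2]
      simp) (by
      rw [integral_sub i2 (i3.const_mul m), integral_const_mul, hψ₀i]
      simp [hm])
  have h1 := h φ hφ1 hφ2 hφ3
  rw [hφ4] at h1
  have h2 : ∫ x in Ioo a b, (ψ x - m * ψ₀ x) • z x
      = (∫ x in Ioo a b, ψ x • z x) - m • c := by
    rw [hc, ← integral_smul, ← integral_sub i1 (i0.fun_smul m)]
    refine integral_congr_ae (Eventually.of_forall fun x => ?_)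
    simp only [sub_smul, mul_smul]
  have h3 : ∫ x in Ioo a b, ψ x • (z x - c) = (∫ x in Ioo a b, ψ x • z x) - m • c := by
    have : m • c = ∫ x in Ioo a b, ψ x • c := by
      rw [integral_smul_const, hm]
      congr 1
      refine (setIntegral_eq_integral_of_forall_compl_eq_zero fun x hx => ?_).symm
      exact image_eq_zero_of_notMem_tsupport (fun h => hx (hψs h))
    rw [this, ← integral_sub i1 (i2.integrableOn.smul_const c)]
    simp only [smul_sub]
  rw [h3, ← h2, h1]

/-- A function with an integrable weak derivative is almost everywhere a primitive of it. -/
theorem HasWeakDeriv.ae_eq_primitive [CompleteSpace E] {a b : ℝ} (hab : a < b) {v w : ℝ → E}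
    (h : HasWeakDeriv a b v w) (hw : IntegrableOn w (Ioo a b)) :
    ∃ c : E, ∀ᵐ x, x ∈ Ioo a b → v x = c + ∫ y in a..x, w y := by
  have hwi : IntervalIntegrable w volume a b := by
    rwa [intervalIntegrable_iff_integrableOn_Ioo_of_le hab.le]
  set F : ℝ → E := fun x => ∫ y in a..x, w y with hF
  have hFac := absolutelyContinuous_primitive hwi
  have hFc : ContinuousOn F (Icc a b) := by
    have := hFac.continuousOn
    rwa [uIcc_of_le hab.le] at this
  have hFi : LocallyIntegrableOn F (Ioo a b) :=
    (hFc.integrableOn_Icc.mono_set Ioo_subset_Icc_self).locallyIntegrableOn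
  obtain ⟨c, hc⟩ := ae_const_of_integral_deriv_smul_eq_zero hab (z := fun x => v x - F x)
    (h.1.sub hFi) (by
    intro φ h1 h2 h3
    have hd : ContDiff ℝ ∞ (deriv φ) := (contDiff_infty_iff_deriv.1 h1).2
    have hds : tsupport (deriv φ) ⊆ Ioo a b := (tsupport_deriv_subset (f := φ)).trans h3
    have i1 := integrableOn_test_smul h.1 hd.continuous h2.deriv hds
    have i2 := integrableOn_test_smul hFi hd.continuous h2.deriv hds
    have i3 := integrableOn_test_smul h.2.1 h1.continuous h2 h3
    have e1 : ∫ x in Ioo a b, deriv φ x • (v x - F x)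
        = (∫ x in Ioo a b, deriv φ x • v x) - ∫ x in Ioo a b, deriv φ x • F x := by
      rw [← integral_sub i1 i2]
      simp only [smul_sub]
    have hφac : AbsolutelyContinuousOnInterval φ a b :=
      (h1.of_le (by simp)).contDiffOn.absolutelyContinuousOnInterval
    have hz : ∀ x ∉ Ioo a b, φ x = 0 := fun x hx =>
      image_eq_zero_of_notMem_tsupport (fun h => hx (h3 h))
    have e2 := integral_eq_sub_of_absolutelyContinuous (hφac.fun_smul hFac)
      (f' := fun x => φ x • w x + deriv φ x • F x) (by
        filter_upwards [hwi.ae_hasDerivAt_integral] with x hx hx'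
        exact (((h1.differentiable (by simp)) x).hasDerivAt).fun_smul (hx hx' a left_mem_uIcc))
      (by
        rw [intervalIntegrable_iff_integrableOn_Ioo_of_le hab.le]
        exact i3.add i2)
    rw [hz a (by simp), hz b (by simp), zero_smul, zero_smul, sub_zero,
      intervalIntegral.integral_of_le hab.le, integral_Ioc_eq_integral_Ioo,
      integral_add i3 i2] at e2
    rw [e1, h.2.2 φ h1 h2 h3, ← neg_add', e2, neg_zero])
  refine ⟨c, ?_⟩
  filter_upwards [hc] with x hx hx'
  rw [← hx hx']
  abel

end WeakDerivative

/-! ### Completeness, traces and integration by parts in `H¹(0,1)` -/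

theorem continuous_integral_test_smul {φ : ℝ → ℝ} (hφ : Continuous φ) (hc : HasCompactSupport φ) :
    Continuous fun v : L2 => ∫ x in Ioo (0 : ℝ) 1, φ x • v x := by
  have hm : MemLp φ 2 (volume.restrict (Ioo (0 : ℝ) 1)) :=
    (hφ.memLp_of_hasCompactSupport hc).restrict _
  have e : (fun v : L2 => ∫ x in Ioo (0 : ℝ) 1, φ x • v x)
      = fun v : L2 => inner ℝ (hm.toLp φ) v := by
    funext v
    rw [L2.inner_def]
    refine integral_congr_ae ?_
    filter_upwards [hm.coeFn_toLp] with x hx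
    rw [hx, smul_eq_mul, real_inner_comm]
    rfl
  rw [e]
  fun_prop

theorem isClosed_H1Space : IsClosed (H1Space : Set (WithLp 2 (L2 × L2))) := by
  have e : (H1Space : Set (WithLp 2 (L2 × L2))) =
      {p | ∀ φ : ℝ → ℝ, ContDiff ℝ ∞ φ → HasCompactSupport φ → tsupport φ ⊆ Ioo (0 : ℝ) 1 →
        ∫ x in Ioo (0 : ℝ) 1, deriv φ x • p.fst x = -∫ x in Ioo (0 : ℝ) 1, φ x • p.snd x} := by
    ext p
    exact ⟨fun h => h.2.2, fun h => ⟨locallyIntegrableOn_coe _, locallyIntegrableOn_coe _, h⟩⟩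
  rw [e]
  simp only [ofPred_forall]
  refine isClosed_iInter fun φ => isClosed_iInter fun h1 => isClosed_iInter fun h2 =>
    isClosed_iInter fun h3 => isClosed_eq ?_ ?_
  · exact (continuous_integral_test_smul (h1.continuous_deriv (by simp)) h2.deriv).comp
      (WithLp.fstL 2 ℝ L2 L2).continuous
  · exact ((continuous_integral_test_smul h1.continuous h2).comp
      (WithLp.sndL 2 ℝ L2 L2).continuous).neg

instance : CompleteSpace H1 := isClosed_H1Space.completeSpace_coe

/-- The inclusion of `H¹(0,1)` in `L²(0,1)` as a continuous linear map. -/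
def H1.toL2CLM : H1 →L[ℝ] L2 := (WithLp.fstL 2 ℝ L2 L2).comp H1Space.subtypeL

/-- The weak derivative as a continuous linear map from `H¹(0,1)` to `L²(0,1)`. -/
def H1.dxCLM : H1 →L[ℝ] L2 := (WithLp.sndL 2 ℝ L2 L2).comp H1Space.subtypeL

theorem H1.toL2CLM_apply (v : H1) : H1.toL2CLM v = v.toL2 := rfl

theorem H1.norm_sq (v : H1) : ‖v‖ ^ 2 = ‖v.toL2‖ ^ 2 + ‖v.dx‖ ^ 2 :=
  WithLp.prod_norm_sq_eq_of_L2 v.1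

theorem H1.norm_toL2_le (v : H1) : ‖v.toL2‖ ≤ ‖v‖ := by
  refine le_of_sq_le_sq ?_ (norm_nonneg _)
  rw [H1.norm_sq]
  linarith [sq_nonneg ‖v.dx‖]

theorem H1.norm_dx_le (v : H1) : ‖v.dx‖ ≤ ‖v‖ := by
  refine le_of_sq_le_sq ?_ (norm_nonneg _)
  rw [H1.norm_sq]
  linarith [sq_nonneg ‖v.toL2‖]

theorem H1.hasWeakDeriv (v : H1) : HasWeakDeriv 0 1 v.toL2 v.dx := v.2

/-- The weak derivative of a function is unique, so that an element of `H¹(0,1)` is determined by the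
underlying function. -/
theorem H1.toL2_injective : Function.Injective H1.toL2 := by
  intro v w hvw
  have h0 : (v - w).toL2 = 0 := by
    have : H1.toL2CLM (v - w) = 0 := by
      rw [map_sub, H1.toL2CLM_apply, H1.toL2CLM_apply, hvw, sub_self]
    exact this
  have h1 : (v - w).dx = 0 := by
    have key := isOpen_Ioo.ae_eq_zero_of_integral_contDiff_smul_eq_zero (μ := volume)
      (U := Ioo (0 : ℝ) 1) (f := (v - w).dx) (locallyIntegrableOn_coe _) (by
        intro φ h1 h2 h3
        have hz : ∀ x ∉ Ioo (0 : ℝ) 1, φ x • (v - w).dx x = 0 := by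
          intro x hx
          rw [image_eq_zero_of_notMem_tsupport (fun h => hx (h3 h)), zero_smul]
        rw [← setIntegral_eq_integral_of_forall_compl_eq_zero hz, ← neg_eq_zero,
          ← (v - w).hasWeakDeriv.2.2 φ h1 h2 h3, h0]
        have := integral_test_smul (deriv φ) 0 (0 : L2)
        rwa [zero_smul, zero_mul] at this)
    refine Lp.ext ?_
    filter_upwards [(ae_restrict_iff' measurableSet_Ioo).2 key,
      Lp.coeFn_zero ℝ 2 (volume.restrict (Ioo (0 : ℝ) 1))] with x hx hx'
    rw [hx, hx', Pi.zero_apply]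
  have h2 : ‖v - w‖ ^ 2 = 0 := by
    rw [H1.norm_sq, h0, h1]
    simp
  exact sub_eq_zero.1 (norm_eq_zero.1 (pow_eq_zero_iff (two_ne_zero) |>.1 h2))

theorem intervalIntegrable_coe (v : L2) : IntervalIntegrable v volume 0 1 := by
  rw [intervalIntegrable_iff_integrableOn_Ioo_of_le zero_le_one]
  exact integrable_coe v

theorem intervalIntegrable_coe_of_mem (v : L2) {x y : ℝ} (hx : x ∈ Icc (0 : ℝ) 1)
    (hy : y ∈ Icc (0 : ℝ) 1) : IntervalIntegrable v volume x y := by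
  rw [← uIcc_of_le zero_le_one] at hx hy
  exact (intervalIntegrable_coe v).mono_set (uIcc_subset_uIcc hx hy)

theorem integral_norm_coe_le (v : L2) : ∫ x in Ioo (0 : ℝ) 1, ‖v x‖ ≤ ‖v‖ := by
  have : IsProbabilityMeasure (volume.restrict (Ioo (0 : ℝ) 1)) := ⟨by simp⟩
  rw [integral_norm_eq_lintegral_enorm (Lp.aestronglyMeasurable v),
    ← eLpNorm_one_eq_lintegral_enorm, Lp.norm_def]
  exact ENNReal.toReal_mono (Lp.eLpNorm_ne_top v)
    (eLpNorm_le_eLpNorm_of_exponent_le (by norm_num) (Lp.aestronglyMeasurable v))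

theorem norm_integral_coe_le (v : L2) {x y : ℝ} (hx : x ∈ Icc (0 : ℝ) 1)
    (hy : y ∈ Icc (0 : ℝ) 1) : ‖∫ z in x..y, v z‖ ≤ ‖v‖ := by
  refine intervalIntegral.norm_integral_le_integral_norm_uIoc.trans
    (le_trans ?_ (integral_norm_coe_le v))
  rw [← integral_Ioc_eq_integral_Ioo]
  have h1 : IntegrableOn (fun z => ‖v z‖) (Ioc (0 : ℝ) 1) :=
    ((intervalIntegrable_iff_integrableOn_Ioc_of_le zero_le_one).1 (intervalIntegrable_coe v)).norm
  refine setIntegral_mono_set h1 (Eventually.of_forall fun _ => norm_nonneg _)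
    (LE.le.eventuallyLE ?_)
  exact Ioc_subset_Ioc (le_min hx.1 hy.1) (max_le hx.2 hy.2)

/-- The representative of `v ∈ H¹(0,1)` picked out by `H1.eval` is the primitive of `v_x`. -/
theorem H1.exists_primitive (v : H1) : ∃ c : ℝ,
    ContinuousOn (fun x => c + ∫ y in (0 : ℝ)..x, v.dx y) (Icc 0 1) ∧
    v.toL2 =ᵐ[volume.restrict (Ioo (0 : ℝ) 1)] fun x => c + ∫ y in (0 : ℝ)..x, v.dx y := by
  obtain ⟨c, hc⟩ := v.hasWeakDeriv.ae_eq_primitive zero_lt_one (integrable_coe _)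
  refine ⟨c, ?_, (ae_restrict_iff' measurableSet_Ioo).2 hc⟩
  have := (absolutelyContinuous_primitive (intervalIntegrable_coe v.dx)).continuousOn
  rw [uIcc_of_le zero_le_one] at this
  exact continuousOn_const.add this

theorem H1.eval_spec (v : H1) : ContinuousOn v.eval (Icc 0 1) ∧
    v.toL2 =ᵐ[volume.restrict (Ioo (0 : ℝ) 1)] v.eval := by
  have h : ∃ c : ℝ → ℝ, ContinuousOn c (Icc 0 1) ∧
      v.toL2 =ᵐ[volume.restrict (Ioo (0 : ℝ) 1)] c := by
    obtain ⟨c, hc⟩ := v.exists_primitive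
    exact ⟨_, hc⟩
  have e : v.eval = h.choose := by
    funext x
    unfold H1.eval contRep
    rw [dif_pos h]
  rw [e]
  exact h.choose_spec

/-- On `[0,1]`, evaluation returns the values of any continuous representative. -/
theorem H1.eqOn_eval (v : H1) {c : ℝ → ℝ} (hc : ContinuousOn c (Icc 0 1))
    (h : v.toL2 =ᵐ[volume.restrict (Ioo (0 : ℝ) 1)] c) : EqOn v.eval c (Icc 0 1) := by
  refine Measure.eqOn_Icc_of_ae_eq volume zero_ne_one ?_ v.eval_spec.1 hc
  rw [← restrict_Ioo_eq_restrict_Icc]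
  exact v.eval_spec.2.symm.trans h

theorem H1.eval_eq_add_integral (v : H1) {x : ℝ} (hx : x ∈ Icc (0 : ℝ) 1) :
    v.eval x = v.eval 0 + ∫ y in (0 : ℝ)..x, v.dx y := by
  obtain ⟨c, hc, hv⟩ := v.exists_primitive
  have h := v.eqOn_eval hc hv
  rw [h hx, h (by simp : (0 : ℝ) ∈ Icc (0 : ℝ) 1)]
  simp

theorem H1.eval_sub_eval (v : H1) {x y : ℝ} (hx : x ∈ Icc (0 : ℝ) 1) (hy : y ∈ Icc (0 : ℝ) 1) :
    v.eval y - v.eval x = ∫ z in x..y, v.dx z := by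
  have h0 : (0 : ℝ) ∈ Icc (0 : ℝ) 1 := by simp
  rw [v.eval_eq_add_integral hx, v.eval_eq_add_integral hy, add_sub_add_left_eq_sub,
    intervalIntegral.integral_interval_sub_left (intervalIntegrable_coe_of_mem _ h0 hy)
      (intervalIntegrable_coe_of_mem _ h0 hx)]

theorem H1.abs_eval_sub_eval_le (v : H1) {x y : ℝ} (hx : x ∈ Icc (0 : ℝ) 1)
    (hy : y ∈ Icc (0 : ℝ) 1) : |v.eval y - v.eval x| ≤ ‖v.dx‖ := by
  rw [v.eval_sub_eval hx hy]
  exact norm_integral_coe_le v.dx hx hy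

theorem H1.abs_eval_le (v : H1) {x : ℝ} (hx : x ∈ Icc (0 : ℝ) 1) : |v.eval x| ≤ 2 * ‖v‖ := by
  have : IsProbabilityMeasure (volume.restrict (Ioo (0 : ℝ) 1)) := ⟨by simp⟩
  have hi : Integrable (fun y => ‖v.toL2 y‖ + ‖v.dx‖) (volume.restrict (Ioo (0 : ℝ) 1)) :=
    (integrable_coe v.toL2).norm.add (integrable_const _)
  have h : ∫ y in Ioo (0 : ℝ) 1, |v.eval x| ≤ ∫ y in Ioo (0 : ℝ) 1, (‖v.toL2 y‖ + ‖v.dx‖) := by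
    refine integral_mono_ae (integrable_const _) hi ?_
    filter_upwards [v.eval_spec.2, ae_restrict_mem measurableSet_Ioo] with y hy hy'
    have h1 := v.abs_eval_sub_eval_le (Ioo_subset_Icc_self hy') hx
    rw [hy, Real.norm_eq_abs]
    have h2 := abs_sub_abs_le_abs_sub (v.eval x) (v.eval y)
    linarith
  rw [integral_add (integrable_coe v.toL2).norm (integrable_const _), integral_const,
    integral_const] at h
  simp only [probReal_univ, one_smul] at h
  have := integral_norm_coe_le v.toL2
  linarith [v.norm_toL2_le, v.norm_dx_le]

theorem H1.eval_add (v w : H1) {x : ℝ} (hx : x ∈ Icc (0 : ℝ) 1) :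
    (v + w).eval x = v.eval x + w.eval x := by
  refine (v + w).eqOn_eval (c := fun x => v.eval x + w.eval x)
    (v.eval_spec.1.add w.eval_spec.1) ?_ hx
  filter_upwards [v.eval_spec.2, w.eval_spec.2, Lp.coeFn_add v.toL2 w.toL2] with y h1 h2 h3
  rw [← h1, ← h2]
  exact h3

theorem H1.eval_smul (r : ℝ) (v : H1) {x : ℝ} (hx : x ∈ Icc (0 : ℝ) 1) :
    (r • v).eval x = r * v.eval x := by
  refine (r • v).eqOn_eval (c := fun x => r * v.eval x)
    (continuousOn_const.mul v.eval_spec.1) ?_ hx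
  filter_upwards [v.eval_spec.2, Lp.coeFn_smul r v.toL2] with y h1 h2
  rw [← h1]
  exact h2

/-- Evaluation at a point of `[0,1]` as a continuous linear functional on `H¹(0,1)`. -/
def H1.evalCLM {x : ℝ} (hx : x ∈ Icc (0 : ℝ) 1) : H1 →L[ℝ] ℝ :=
  LinearMap.mkContinuous
    { toFun := fun v => v.eval x
      map_add' := fun v w => v.eval_add w hx
      map_smul' := fun r v => v.eval_smul r hx } 2 fun v => v.abs_eval_le hx

theorem H1.eval_one_sq_le (v : H1) : v.eval 1 ^ 2 ≤ 2 * v.eval 0 ^ 2 + 2 * ‖v.dx‖ ^ 2 := by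
  have h := v.abs_eval_sub_eval_le (x := 0) (y := 1) (by simp) (by simp)
  have h2 : (v.eval 1 - v.eval 0) ^ 2 ≤ ‖v.dx‖ ^ 2 := by
    rw [← sq_abs (v.eval 1 - v.eval 0)]
    gcongr
  nlinarith [sq_nonneg (v.eval 1 - 2 * v.eval 0)]

/-- Integration by parts for functions in `H¹(0,1)`. -/
theorem H1.inner_dx_toL2 (v w : H1) :
    inner ℝ v.dx w.toL2 = v.eval 1 * w.eval 1 - v.eval 0 * w.eval 0 - inner ℝ v.toL2 w.dx := by
  have pv := absolutelyContinuous_primitive (intervalIntegrable_coe v.dx)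
  have pw := absolutelyContinuous_primitive (intervalIntegrable_coe w.dx)
  have cst : ∀ r : ℝ, AbsolutelyContinuousOnInterval (fun _ => r) 0 1 := fun r =>
    (contDiffOn_const (c := r)).absolutelyContinuousOnInterval
  have av := (cst (v.eval 0)).fun_add pv
  have aw := (cst (w.eval 0)).fun_add pw
  have ev : ∀ x ∈ Icc (0 : ℝ) 1, v.eval 0 + ∫ y in (0 : ℝ)..x, v.dx y = v.eval x :=
    fun x hx => (v.eval_eq_add_integral hx).symm
  have ew : ∀ x ∈ Icc (0 : ℝ) 1, w.eval 0 + ∫ y in (0 : ℝ)..x, w.dx y = w.eval x :=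
    fun x hx => (w.eval_eq_add_integral hx).symm
  have i1 : IntervalIntegrable (fun x => v.dx x * (w.eval 0 + ∫ y in (0 : ℝ)..x, w.dx y))
      volume 0 1 := (intervalIntegrable_coe v.dx).mul_continuousOn aw.continuousOn
  have i2 : IntervalIntegrable (fun x => (v.eval 0 + ∫ y in (0 : ℝ)..x, v.dx y) * w.dx x)
      volume 0 1 := (intervalIntegrable_coe w.dx).continuousOn_mul av.continuousOn
  have key := integral_eq_sub_of_absolutelyContinuous (av.fun_mul aw)
    (f' := fun x => v.dx x * (w.eval 0 + ∫ y in (0 : ℝ)..x, w.dx y)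
      + (v.eval 0 + ∫ y in (0 : ℝ)..x, v.dx y) * w.dx x) (by
      filter_upwards [(intervalIntegrable_coe v.dx).ae_hasDerivAt_integral,
        (intervalIntegrable_coe w.dx).ae_hasDerivAt_integral] with x h1 h2 hx
      exact ((h1 hx 0 left_mem_uIcc).const_add _).fun_mul ((h2 hx 0 left_mem_uIcc).const_add _))
    (i1.add i2)
  rw [intervalIntegral.integral_add i1 i2, ev 1 (by simp), ev 0 (by simp), ew 1 (by simp),
    ew 0 (by simp)] at key
  have e1 : inner ℝ v.dx w.toL2
      = ∫ x in (0 : ℝ)..1, v.dx x * (w.eval 0 + ∫ y in (0 : ℝ)..x, w.dx y) := by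
    rw [intervalIntegral.integral_of_le zero_le_one, integral_Ioc_eq_integral_Ioo, L2.inner_def]
    refine integral_congr_ae ?_
    filter_upwards [w.eval_spec.2, ae_restrict_mem measurableSet_Ioo] with x hx hx'
    rw [ew x (Ioo_subset_Icc_self hx'), ← hx, real_inner_comm]
    rfl
  have e2 : inner ℝ v.toL2 w.dx
      = ∫ x in (0 : ℝ)..1, (v.eval 0 + ∫ y in (0 : ℝ)..x, v.dx y) * w.dx x := by
    rw [intervalIntegral.integral_of_le zero_le_one, integral_Ioc_eq_integral_Ioo, L2.inner_def]
    refine integral_congr_ae ?_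
    filter_upwards [v.eval_spec.2, ae_restrict_mem measurableSet_Ioo] with x hx hx'
    rw [ev x (Ioo_subset_Icc_self hx'), ← hx, real_inner_comm]
    rfl
  rw [e1, e2]
  linarith

/-! ### Time regularity of strong solutions -/

section Time

/-- A primitive of an integrable function is absolutely continuous, and it is differentiable almost
everywhere by Lebesgue's theorem. -/
theorem absolutelyContinuous_and_ae_hasDerivAt {E : Type*} [NormedAddCommGroup E]
    [NormedSpace ℝ E] [CompleteSpace E] {f w : ℝ → E} {T : ℝ} (hT : 0 < T)
    (hw : IntervalIntegrable w volume 0 T)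
    (h : ∀ t ∈ Icc 0 T, f t = f 0 + ∫ s in (0 : ℝ)..t, w s) :
    AbsolutelyContinuousOnInterval f 0 T ∧ ∀ᵐ t, t ∈ Icc 0 T → HasDerivAt f (w t) t := by
  have hac := absolutelyContinuous_primitive hw
  constructor
  · refine absolutelyContinuous_of_dist_le hac hac 1 fun x hx y hy => ?_
    rw [uIcc_of_le hT.le] at hx hy
    rw [h x hx, h y hy, dist_add_left, one_mul]
    exact le_add_of_nonneg_left dist_nonneg
  · filter_upwards [hw.ae_hasDerivAt_integral, Measure.ae_ne volume 0, Measure.ae_ne volume T]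
      with t h1 h2 h3 ht
    have ht' : t ∈ Ioo 0 T := ⟨lt_of_le_of_ne ht.1 (Ne.symm h2), lt_of_le_of_ne ht.2 h3⟩
    have h4 := (h1 (by rwa [uIcc_of_le hT.le]) 0 left_mem_uIcc).const_add (f 0)
    refine h4.congr_of_eventuallyEq ?_
    filter_upwards [isOpen_Ioo.mem_nhds ht'] with s hs
    exact h s (Ioo_subset_Icc_self hs)

theorem MemLinftyLoc.intervalIntegrable {X : Type*} [NormedAddCommGroup X] {v : ℝ → X}
    (hv : MemLinftyLoc v) {T : ℝ} (hT : 0 < T) : IntervalIntegrable v volume 0 T := by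
  rw [intervalIntegrable_iff_integrableOn_Ioo_of_le hT.le]
  exact (hv T hT).integrable le_top

variable {u : ℝ → H1}

theorem continuousOn_timeDeriv (hu : ContDiffOn ℝ 1 (fun t => (u t).toL2) (Ici 0)) :
    ContinuousOn (timeDeriv u) (Ici 0) :=
  hu.continuousOn_derivWithin (uniqueDiffOn_Ici 0) le_rfl

theorem hasDerivAt_toL2 (hu : ContDiffOn ℝ 1 (fun t => (u t).toL2) (Ici 0)) {t : ℝ}
    (ht : 0 < t) : HasDerivAt (fun t => (u t).toL2) (timeDeriv u t) t :=
  ((hu.differentiableOn one_ne_zero t ht.le).hasDerivWithinAt).hasDerivAt (Ici_mem_nhds ht)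

/-- If `u_t` lies in `H¹(0,1)` almost everywhere, then `u` is a primitive of `u_t` in `H¹(0,1)`, and
not only in `L²(0,1)`. -/
theorem eq_add_integral_of_toL2_eq_timeDeriv
    (hu : ContDiffOn ℝ 1 (fun t => (u t).toL2) (Ici 0)) {V : ℝ → H1} (hV : MemLinftyLoc V)
    (hVu : ∀ᵐ t ∂volume.restrict (Ioi (0 : ℝ)), (V t).toL2 = timeDeriv u t) {T : ℝ} (hT : 0 < T) :
    ∀ t ∈ Icc 0 T, u t = u 0 + ∫ s in (0 : ℝ)..t, V s := by
  intro t ht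
  have hVi : IntervalIntegrable V volume 0 t := by
    refine (hV.intervalIntegrable hT).mono_set (uIcc_subset_uIcc left_mem_uIcc ?_)
    rwa [uIcc_of_le hT.le]
  refine H1.toL2_injective ?_
  have hcont : ContinuousOn (timeDeriv u) (Icc 0 t) :=
    (continuousOn_timeDeriv hu).mono Icc_subset_Ici_self
  have e1 : ∫ s in (0 : ℝ)..t, timeDeriv u s = (u t).toL2 - (u 0).toL2 := by
    refine intervalIntegral.integral_eq_sub_of_hasDerivAt_of_le (f := fun t => (u t).toL2) ht.1
      (hu.continuousOn.mono Icc_subset_Ici_self)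
      (fun s hs => hasDerivAt_toL2 hu hs.1) ?_
    exact ContinuousOn.intervalIntegrable (by rwa [uIcc_of_le ht.1])
  have e2 : ∫ s in (0 : ℝ)..t, H1.toL2CLM (V s) = ∫ s in (0 : ℝ)..t, timeDeriv u s := by
    refine intervalIntegral.integral_congr_ae ?_
    filter_upwards [(ae_restrict_iff' measurableSet_Ioi).1 hVu] with s hs hs'
    rw [uIoc_of_le ht.1] at hs'
    exact hs hs'.1
  have e3 := H1.toL2CLM.intervalIntegral_comp_comm hVi
  have e4 : (u 0 + ∫ s in (0 : ℝ)..t, V s).toL2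
      = (u 0).toL2 + H1.toL2CLM (∫ s in (0 : ℝ)..t, V s) := rfl
  rw [e4, ← e3, e2, e1]
  abel

/-- The velocity is continuous in `L²(0,1)`, hence equal at every time to the primitive of its weak
derivative `u_tt`. -/
theorem timeDeriv_eq_add_integral
    (hu : ContDiffOn ℝ 1 (fun t => (u t).toL2) (Ici 0)) {W : ℝ → L2} (hW : MemLinftyLoc W)
    {T : ℝ} (hT : 0 < T) (hWu : HasWeakDeriv 0 T (timeDeriv u) W) :
    ∀ t ∈ Icc 0 T, timeDeriv u t = timeDeriv u 0 + ∫ s in (0 : ℝ)..t, W s := by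
  have hWi := hW.intervalIntegrable hT
  obtain ⟨c, hc⟩ := hWu.ae_eq_primitive hT
    ((intervalIntegrable_iff_integrableOn_Ioo_of_le hT.le).1 hWi)
  have hp := (absolutelyContinuous_primitive hWi).continuousOn
  rw [uIcc_of_le hT.le] at hp
  have key : EqOn (timeDeriv u) (fun t => c + ∫ s in (0 : ℝ)..t, W s) (Icc 0 T) := by
    refine Measure.eqOn_Icc_of_ae_eq volume hT.ne ?_
      ((continuousOn_timeDeriv hu).mono Icc_subset_Ici_self) (continuousOn_const.add hp)
    rw [← restrict_Ioo_eq_restrict_Icc]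
    exact (ae_restrict_iff' measurableSet_Ioo).2 hc
  have h0 : timeDeriv u 0 = c := by
    have := key (left_mem_Icc.2 hT.le)
    simpa using this
  intro t ht
  rw [h0]
  exact key ht

end Time

/-! ### The perturbed energy and its derivative along a solution -/

section Energy

/-- The energy functional on the phase space `H¹(0,1) × L²(0,1)`, with the multiplier term
`ε ⟨w, z⟩` added. -/
def perturbedEnergy (h0 h1 K ε : ℝ) (w : H1) (z : L2) : ℝ :=
  1 / 2 * ‖z‖ ^ 2 + 1 / 2 * (‖w.dx‖ ^ 2 + h0 * w.eval 0 ^ 2 + h1 * w.eval 1 ^ 2)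
    + K / 2 * ‖w.toL2‖ ^ 2 + ε * inner ℝ w.toL2 z

/-- The energy is the perturbed energy with `ε = 0`. Nonnegativity of `h0` and `h1` makes the square
root in `aNorm` that of a nonnegative number. -/
theorem energy_eq_perturbedEnergy {h0 h1 : ℝ} (hh0 : 0 ≤ h0) (hh1 : 0 ≤ h1) (K : ℝ) (u : ℝ → H1)
    (t : ℝ) : energy h0 h1 K u t = perturbedEnergy h0 h1 K 0 (u t) (timeDeriv u t) := by
  have h : 0 ≤ aForm h0 h1 (u t) (u t) := by
    unfold aForm
    rw [real_inner_self_eq_norm_sq, mul_assoc, mul_assoc]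
    have := mul_self_nonneg ((u t).eval 0)
    have := mul_self_nonneg ((u t).eval 1)
    positivity
  unfold energy perturbedEnergy aNorm
  rw [Real.sq_sqrt h, aForm, real_inner_self_eq_norm_sq]
  ring

theorem absolutelyContinuous_perturbedEnergy (h0 h1 K ε : ℝ) {w : ℝ → H1} {z : ℝ → L2} {a b : ℝ}
    (hw : AbsolutelyContinuousOnInterval w a b) (hz : AbsolutelyContinuousOnInterval z a b) :
    AbsolutelyContinuousOnInterval (fun t => perturbedEnergy h0 h1 K ε (w t) (z t)) a b := by
  have d := absolutelyContinuous_clm H1.dxCLM hw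
  have l := absolutelyContinuous_clm H1.toL2CLM hw
  have e0 := absolutelyContinuous_clm (H1.evalCLM (x := 0) (by simp)) hw
  have e1 := absolutelyContinuous_clm (H1.evalCLM (x := 1) (by simp)) hw
  have key := (((absolutelyContinuous_inner hz hz).const_mul (1 / 2)).fun_add
    ((((absolutelyContinuous_inner d d).fun_add ((e0.fun_mul e0).const_mul h0)).fun_add
      ((e1.fun_mul e1).const_mul h1)).const_mul (1 / 2))).fun_add
    ((absolutelyContinuous_inner l l).const_mul (K / 2)) |>.fun_add
    ((absolutelyContinuous_inner l hz).const_mul ε)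
  refine absolutelyContinuous_of_dist_le key key 1 fun x _ y _ => ?_
  have e : ∀ t, perturbedEnergy h0 h1 K ε (w t) (z t)
      = 1 / 2 * inner ℝ (z t) (z t) + 1 / 2 * (inner ℝ (w t).dx (w t).dx
        + h0 * ((w t).eval 0 * (w t).eval 0) + h1 * ((w t).eval 1 * (w t).eval 1))
        + K / 2 * inner ℝ (w t).toL2 (w t).toL2 + ε * inner ℝ (w t).toL2 (z t) := by
    intro t
    simp only [perturbedEnergy, real_inner_self_eq_norm_sq, sq]
  rw [e x, e y, one_mul]
  exact le_add_of_nonneg_left dist_nonneg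

theorem hasDerivAt_perturbedEnergy (h0 h1 K ε : ℝ) {w : ℝ → H1} {z : ℝ → L2} {V : H1} {W : L2}
    {t : ℝ} (hw : HasDerivAt w V t) (hz : HasDerivAt z W t) :
    HasDerivAt (fun t => perturbedEnergy h0 h1 K ε (w t) (z t))
      (inner ℝ (z t) W + (inner ℝ (w t).dx V.dx + h0 * ((w t).eval 0 * V.eval 0)
        + h1 * ((w t).eval 1 * V.eval 1)) + K * inner ℝ (w t).toL2 V.toL2
        + ε * (inner ℝ (w t).toL2 W + inner ℝ V.toL2 (z t))) t := by
  have d : HasDerivAt (fun t => (w t).dx) V.dx t := H1.dxCLM.hasFDerivAt.comp_hasDerivAt t hw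
  have l : HasDerivAt (fun t => (w t).toL2) V.toL2 t :=
    H1.toL2CLM.hasFDerivAt.comp_hasDerivAt t hw
  have e0 : HasDerivAt (fun t => (w t).eval 0) (V.eval 0) t :=
    (H1.evalCLM (x := 0) (by simp)).hasFDerivAt.comp_hasDerivAt t hw
  have e1 : HasDerivAt (fun t => (w t).eval 1) (V.eval 1) t :=
    (H1.evalCLM (x := 1) (by simp)).hasFDerivAt.comp_hasDerivAt t hw
  have key := ((((hz.norm_sq).const_mul (1 / 2)).fun_add
    (((d.norm_sq.fun_add ((e0.fun_pow 2).const_mul h0)).fun_add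
      ((e1.fun_pow 2).const_mul h1)).const_mul (1 / 2))).fun_add
    (l.norm_sq.const_mul (K / 2))).fun_add ((l.inner ℝ hz).const_mul ε)
  unfold perturbedEnergy
  refine key.congr_deriv ?_
  simp only [Nat.cast_ofNat, Nat.add_one_sub_one, pow_one]
  ring

/-- The multiplier identity: the time derivative of the perturbed energy along a solution, after
integration by parts in `x` and insertion of the boundary conditions. -/
theorem perturbedEnergy_deriv_eq {c : Coeffs} {U : H2} {V w : H1} {W z f : L2} {g0 g1 : ℝ} (ε : ℝ)
    (hU : U.toH1 = w) (hV : V.toL2 = z)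
    (heq : W - U.dx.dx + c.K • w.toL2 + c.lam • z = f)
    (hb0 : U.dx.eval 0 = c.h0 * w.eval 0 + c.lam0 * V.eval 0
        + c.ht1 * w.eval 1 + c.lamt1 * V.eval 1 + g0)
    (hb1 : -U.dx.eval 1 = c.h1 * w.eval 1 + c.lam1 * V.eval 1
        + c.ht0 * w.eval 0 + c.lamt0 * V.eval 0 + g1) :
    inner ℝ z W + (inner ℝ w.dx V.dx + c.h0 * (w.eval 0 * V.eval 0)
        + c.h1 * (w.eval 1 * V.eval 1)) + c.K * inner ℝ w.toL2 V.toL2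
        + ε * (inner ℝ w.toL2 W + inner ℝ V.toL2 z)
    = inner ℝ z f - c.lam * ‖z‖ ^ 2
      - (c.lam0 * V.eval 0 + c.ht1 * w.eval 1 + c.lamt1 * V.eval 1 + g0) * V.eval 0
      - (c.lam1 * V.eval 1 + c.ht0 * w.eval 0 + c.lamt0 * V.eval 0 + g1) * V.eval 1
      + ε * (‖z‖ ^ 2 - (‖w.dx‖ ^ 2 + c.h0 * w.eval 0 ^ 2 + c.h1 * w.eval 1 ^ 2)
        - c.K * ‖w.toL2‖ ^ 2 - c.lam * inner ℝ w.toL2 z + inner ℝ w.toL2 f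
        - (c.lam0 * V.eval 0 + c.ht1 * w.eval 1 + c.lamt1 * V.eval 1 + g0) * w.eval 0
        - (c.lam1 * V.eval 1 + c.ht0 * w.eval 0 + c.lamt0 * V.eval 0 + g1) * w.eval 1) := by
  have hx : U.dx.toL2 = w.dx := by rw [← hU]; rfl
  have hW : W = f + U.dx.dx - c.K • w.toL2 - c.lam • z := by
    rw [← heq]; abel
  have g1' := U.dx.inner_dx_toL2 V
  have g2' := U.dx.inner_dx_toL2 w
  rw [hx] at g1' g2'
  rw [hV] at g1' ⊢
  have i1 : inner ℝ z W = inner ℝ z f + inner ℝ U.dx.dx z - c.K * inner ℝ w.toL2 z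
      - c.lam * ‖z‖ ^ 2 := by
    rw [hW, inner_sub_right, inner_sub_right, inner_add_right, inner_smul_right, inner_smul_right,
      real_inner_self_eq_norm_sq, real_inner_comm z U.dx.dx, real_inner_comm z w.toL2]
  have i2 : inner ℝ w.toL2 W = inner ℝ w.toL2 f + inner ℝ U.dx.dx w.toL2
      - c.K * ‖w.toL2‖ ^ 2 - c.lam * inner ℝ w.toL2 z := by
    rw [hW, inner_sub_right, inner_sub_right, inner_add_right, inner_smul_right, inner_smul_right,
      real_inner_self_eq_norm_sq, real_inner_comm w.toL2 U.dx.dx]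
  have hb1' : U.dx.eval 1 = -(c.h1 * w.eval 1 + c.lam1 * V.eval 1
        + c.ht0 * w.eval 0 + c.lamt0 * V.eval 0 + g1) := by rw [← hb1, neg_neg]
  rw [i1, i2, g1', g2', hb0, hb1', real_inner_self_eq_norm_sq, real_inner_self_eq_norm_sq]
  ring

end Energy

/-! ### The dissipation inequality -/

theorem mul_le_sq_add_sq_div {r : ℝ} (hr : 0 < r) (a b : ℝ) :
    a * b ≤ r * a ^ 2 + b ^ 2 / (4 * r) := by
  have h : r * a ^ 2 + b ^ 2 / (4 * r) - a * b = (2 * r * a - b) ^ 2 / (4 * r) := by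
    field_simp
    ring
  have : 0 ≤ (2 * r * a - b) ^ 2 / (4 * r) := by positivity
  linarith

/-- The condition `|s| < 2 √(l₀ l₁)` says that the boundary damping is a positive definite quadratic
form. -/
theorem exists_coercive {l0 l1 s : ℝ} (h0 : 0 < l0) (h1 : 0 < l1)
    (hs : |s| < 2 * Real.sqrt (l0 * l1)) :
    ∃ c : ℝ, 0 < c ∧ ∀ p q : ℝ, c * (p ^ 2 + q ^ 2) ≤ l0 * p ^ 2 + s * p * q + l1 * q ^ 2 := by
  have hs2 : s ^ 2 < 4 * (l0 * l1) := by
    have h := pow_lt_pow_left₀ hs (abs_nonneg s) two_ne_zero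
    rw [sq_abs, mul_pow, Real.sq_sqrt (by positivity)] at h
    linarith
  have hsum : 0 < l0 + l1 := by linarith
  -- This value gives `(l0 - c) * (l1 - c) = s ^ 2 / 4 + c ^ 2`, so that the form stays nonnegative
  -- after subtraction of `c * (p ^ 2 + q ^ 2)`.
  obtain ⟨c, hc⟩ : ∃ c, c = (4 * (l0 * l1) - s ^ 2) / (4 * (l0 + l1)) := ⟨_, rfl⟩
  have hc0 : 0 < c := by
    rw [hc]
    exact div_pos (by linarith) (by linarith)
  have hceq : c * (l0 + l1) = l0 * l1 - s ^ 2 / 4 := by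
    rw [hc]
    field_simp
  have hcl : 0 < l0 - c := by
    by_contra hcon
    nlinarith [sq_nonneg s, mul_pos h0 h0]
  refine ⟨c, hc0, fun p q => ?_⟩
  have key : (l0 - c) * ((l0 - c) * p ^ 2 + s * p * q + (l1 - c) * q ^ 2)
      = ((l0 - c) * p + s * q / 2) ^ 2 + c ^ 2 * q ^ 2 := by
    linear_combination (-q ^ 2) * hceq
  have : 0 ≤ (l0 - c) * p ^ 2 + s * p * q + (l1 - c) * q ^ 2 := by
    refine nonneg_of_mul_nonneg_right (a := l0 - c) ?_ hcl
    rw [key]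
    positivity
  linarith

theorem linear_comb_sq_le {a b Q : ℝ} (h : a ^ 2 + b ^ 2 ≤ Q) (p q : ℝ) :
    (a * p + b * q) ^ 2 ≤ Q * (p ^ 2 + q ^ 2) := by
  have h1 : (a * p + b * q) ^ 2 ≤ (a ^ 2 + b ^ 2) * (p ^ 2 + q ^ 2) := by
    nlinarith [sq_nonneg (a * q - b * p)]
  exact h1.trans (mul_le_mul_of_nonneg_right h (by positivity))

/-- The pointwise inequality behind the decay of the perturbed energy. Here `N = ‖u_t‖`,
`B = ‖u‖`, `D = ‖u_x‖`, `x = u(0)`, `y = u(1)`, `p = u_t(0)`, `q = u_t(1)`, `I = ⟨u, u_t⟩`,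
`J = ⟨u_t, f⟩`, `L = ⟨u, f⟩` and `F = ‖f‖`. -/
theorem exists_dissipation {h0 h1 lam0 lam1 lamt0 lamt1 K lam : ℝ}
    (hh0 : 0 < h0) (hh1 : 0 ≤ h1) (hlam0 : 0 < lam0) (hlam1 : 0 < lam1)
    (hlamt : |lamt0 + lamt1| < 2 * Real.sqrt (lam0 * lam1)) (hK : 0 < K) (hlam : 0 < lam) :
    ∃ ε η κ C : ℝ, 0 < ε ∧ 0 < η ∧ 0 < κ ∧ 0 < C ∧ ε ≤ 1 / 2 ∧ ε ≤ K / 2 ∧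
      ∀ ht0 ht1 : ℝ, |ht0| ≤ η → |ht1| ≤ η → ∀ x y p q N B D F g0 g1 I J L : ℝ,
      |I| ≤ B * N → |J| ≤ N * F → |L| ≤ B * F →
      y ^ 2 ≤ 2 * x ^ 2 + 2 * D ^ 2 →
      J - lam * N ^ 2 - (lam0 * p + ht1 * y + lamt1 * q + g0) * p
        - (lam1 * q + ht0 * x + lamt0 * p + g1) * q
        + ε * (N ^ 2 - (D ^ 2 + h0 * x ^ 2 + h1 * y ^ 2) - K * B ^ 2 - lam * I + L
          - (lam0 * p + ht1 * y + lamt1 * q + g0) * x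
          - (lam1 * q + ht0 * x + lamt0 * p + g1) * y)
      ≤ -κ * (1 / 2 * N ^ 2 + 1 / 2 * (D ^ 2 + h0 * x ^ 2 + h1 * y ^ 2) + K / 2 * B ^ 2)
        + C * (F ^ 2 + g0 ^ 2 + g1 ^ 2) := by
  obtain ⟨c, hc, hcoer⟩ := exists_coercive hlam0 hlam1 hlamt
  -- `C0` bounds the sum of the squared traces by `‖u‖_a²`; this is where `0 < h0` enters.
  obtain ⟨C0, hC0⟩ : ∃ C0, C0 = 3 / h0 + 2 := ⟨_, rfl⟩
  have hC0p : 0 < C0 := by rw [hC0]; positivity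
  obtain ⟨Q, hQ⟩ : ∃ Q, Q = lam0 ^ 2 + lam1 ^ 2 + lamt0 ^ 2 + lamt1 ^ 2 := ⟨_, rfl⟩
  have hQp : 0 < Q := by rw [hQ]; positivity
  -- `ε` is chosen so small that the damping absorbs what the multiplier produces in `N`, `p` and `q`;
  -- `η` comes after `ε`, as the coupling terms have to be absorbed by `ε * A`.
  obtain ⟨ε, hε⟩ : ∃ ε, ε = min (min (1 / 2) (K / 2))
    (min (lam / 4 / (1 + lam ^ 2 / K)) (c / 4 / (4 * C0 * Q))) := ⟨_, rfl⟩
  have hεp : 0 < ε := by rw [hε]; positivity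
  have hε1 : ε ≤ 1 / 2 := by rw [hε]; exact (min_le_left _ _).trans (min_le_left _ _)
  have hε2 : ε ≤ K / 2 := by rw [hε]; exact (min_le_left _ _).trans (min_le_right _ _)
  have hε3 : ε * (1 + lam ^ 2 / K) ≤ lam / 4 := by
    rw [← le_div_iff₀ (by positivity), hε]
    exact (min_le_right _ _).trans (min_le_left _ _)
  have hε4 : ε * (4 * C0 * Q) ≤ c / 4 := by
    rw [← le_div_iff₀ (by positivity), hε]
    exact (min_le_right _ _).trans (min_le_right _ _)
  obtain ⟨η, hη⟩ : ∃ η, η = min (c / 2) (min (1 / 8 / C0) (ε / 4 / C0)) := ⟨_, rfl⟩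
  have hηp : 0 < η := by rw [hη]; positivity
  have hη1 : η ≤ c / 2 := by rw [hη]; exact min_le_left _ _
  have hη2 : η * C0 ≤ 1 / 8 := by
    rw [← le_div_iff₀ hC0p, hη]
    exact (min_le_right _ _).trans (min_le_left _ _)
  have hη3 : η * C0 ≤ ε / 4 := by
    rw [← le_div_iff₀ hC0p, hη]
    exact (min_le_right _ _).trans (min_le_right _ _)
  refine ⟨ε, η, min lam ε, 1 / lam + ε / K + (1 / c + 2 * ε * C0), hεp, hηp, lt_min hlam hεp,
    by positivity, hε1, hε2, ?_⟩
  intro ht0 ht1 hht0 hht1 x y p q N B D F g0 g1 I J L hI hJ hL hy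
  obtain ⟨A, hA⟩ : ∃ A, A = D ^ 2 + h0 * x ^ 2 + h1 * y ^ 2 := ⟨_, rfl⟩
  obtain ⟨S, hS⟩ : ∃ S, S = x ^ 2 + y ^ 2 := ⟨_, rfl⟩
  obtain ⟨P, hP⟩ : ∃ P, P = p ^ 2 + q ^ 2 := ⟨_, rfl⟩
  have hA0 : 0 ≤ A := by rw [hA]; positivity
  have hP0 : 0 ≤ P := by rw [hP]; positivity
  have hS0 : 0 ≤ S := by rw [hS]; positivity
  have hSA : S ≤ C0 * A := by
    have hxA : x ^ 2 ≤ A / h0 := by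
      rw [le_div_iff₀ hh0, hA]
      linarith [sq_nonneg D, mul_nonneg hh1 (sq_nonneg y)]
    have hDA : D ^ 2 ≤ A := by
      rw [hA]
      linarith [mul_nonneg hh0.le (sq_nonneg x), mul_nonneg hh1 (sq_nonneg y)]
    have : C0 * A = 3 * (A / h0) + 2 * A := by rw [hC0]; ring
    rw [hS, this]
    linarith
  -- Young's inequality, term by term.
  have b1 : J ≤ lam / 4 * N ^ 2 + F ^ 2 / lam := by
    have := mul_le_sq_add_sq_div (r := lam / 4) (by positivity) N F
    have e : 4 * (lam / 4) = lam := by ring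
    rw [e] at this
    linarith [le_abs_self J]
  have b2 : -(lam * I) ≤ K / 4 * B ^ 2 + lam ^ 2 / K * N ^ 2 := by
    have := mul_le_sq_add_sq_div (r := K / 4) (by positivity) B (lam * N)
    have e : (lam * N) ^ 2 / (4 * (K / 4)) = lam ^ 2 / K * N ^ 2 := by field_simp
    rw [e] at this
    have h := mul_le_mul_of_nonneg_left ((neg_le_abs I).trans hI) hlam.le
    linarith
  have b3 : L ≤ K / 4 * B ^ 2 + F ^ 2 / K := by
    have := mul_le_sq_add_sq_div (r := K / 4) (by positivity) B F
    have e : 4 * (K / 4) = K := by ring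
    rw [e] at this
    linarith [le_abs_self L]
  have b4 : -(g0 * p) - g1 * q ≤ c / 4 * P + (g0 ^ 2 + g1 ^ 2) / c := by
    have e1 := mul_le_sq_add_sq_div (r := c / 4) (by positivity) p (-g0)
    have e2 := mul_le_sq_add_sq_div (r := c / 4) (by positivity) q (-g1)
    have e : 4 * (c / 4) = c := by ring
    rw [e, neg_sq] at e1 e2
    rw [hP, add_div]
    linarith
  have habs : ∀ h a b : ℝ, |h| ≤ η → -(h * a * b) ≤ η / 2 * (a ^ 2 + b ^ 2) := by
    intro h a b hh
    have h1 : -(h * a * b) ≤ |h| * (|a| * |b|) := by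
      rw [← abs_mul, ← abs_mul, ← mul_assoc]
      exact neg_le_abs _
    have h2 : |h| * (|a| * |b|) ≤ η * (|a| * |b|) := by gcongr
    have h3 : |a| * |b| ≤ (a ^ 2 + b ^ 2) / 2 := by
      have := sq_nonneg (|a| - |b|)
      rw [sub_sq, sq_abs, sq_abs] at this
      linarith
    have h4 := mul_le_mul_of_nonneg_left h3 hηp.le
    linarith
  have b5 : -(ht1 * y * p) - ht0 * x * q ≤ η / 2 * (S + P) := by
    have := habs ht1 y p hht1
    have := habs ht0 x q hht0
    rw [hS, hP]
    linarith
  have b6 : -(ht1 * y * x) - ht0 * x * y ≤ η * S := by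
    have := habs ht1 y x hht1
    have := habs ht0 x y hht0
    rw [hS]
    linarith
  have hδ : 0 < 1 / (8 * C0) := by positivity
  have hδS : 1 / (8 * C0) * S ≤ A / 8 := by
    have := mul_le_mul_of_nonneg_left hSA hδ.le
    have e : 1 / (8 * C0) * (C0 * A) = A / 8 := by field_simp
    linarith
  have hδe : ∀ a : ℝ, a / (4 * (1 / (8 * C0))) = 2 * C0 * a := by
    intro a
    field_simp
    ring
  have b7 : -((lam0 * p + lamt1 * q) * x) - (lam1 * q + lamt0 * p) * y
      ≤ A / 8 + 4 * C0 * Q * P := by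
    have e1 := mul_le_sq_add_sq_div hδ x (-(lam0 * p + lamt1 * q))
    have e2 := mul_le_sq_add_sq_div hδ y (-(lamt0 * p + lam1 * q))
    have e3 := linear_comb_sq_le (a := lam0) (b := lamt1) (Q := Q)
      (by rw [hQ]; linarith [sq_nonneg lam1, sq_nonneg lamt0]) p q
    have e4 := linear_comb_sq_le (a := lamt0) (b := lam1) (Q := Q)
      (by rw [hQ]; linarith [sq_nonneg lam0, sq_nonneg lamt1]) p q
    rw [hδe, neg_sq] at e1 e2
    rw [← hP] at e3 e4
    have e5 := mul_le_mul_of_nonneg_left e3 hC0p.le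
    have e6 := mul_le_mul_of_nonneg_left e4 hC0p.le
    rw [hS] at hδS
    linarith
  have b8 : -(g0 * x) - g1 * y ≤ A / 8 + 2 * C0 * (g0 ^ 2 + g1 ^ 2) := by
    have e1 := mul_le_sq_add_sq_div hδ x (-g0)
    have e2 := mul_le_sq_add_sq_div hδ y (-g1)
    rw [hδe, neg_sq] at e1 e2
    rw [hS] at hδS
    linarith
  have b9 := hcoer p q
  rw [← hP] at b9
  rw [← hA]
  -- The smallness of `ε` and `η` absorbs the error terms.
  have c1 : η * S ≤ A / 8 := by
    have h1 := mul_le_mul_of_nonneg_left hSA hηp.le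
    have h2 := mul_le_mul_of_nonneg_right hη2 hA0
    linarith
  have c2 : η / 2 * S ≤ ε / 8 * A := by
    have h1 := mul_le_mul_of_nonneg_left hSA hηp.le
    have h2 := mul_le_mul_of_nonneg_right hη3 hA0
    linarith
  have c3 : η / 2 * P ≤ c / 4 * P := by
    have := mul_le_mul_of_nonneg_right hη1 hP0
    linarith
  have c4 : ε * (4 * C0 * Q * P) ≤ c / 4 * P := by
    have := mul_le_mul_of_nonneg_right hε4 hP0
    linarith
  have c5 : ε * N ^ 2 + ε * (lam ^ 2 / K * N ^ 2) ≤ lam / 4 * N ^ 2 := by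
    have := mul_le_mul_of_nonneg_right hε3 (sq_nonneg N)
    linarith
  have inner_le : N ^ 2 - A - K * B ^ 2 - lam * I + L
      - (lam0 * p + ht1 * y + lamt1 * q + g0) * x
      - (lam1 * q + ht0 * x + lamt0 * p + g1) * y
      ≤ N ^ 2 + lam ^ 2 / K * N ^ 2 - 5 / 8 * A - K / 2 * B ^ 2 + F ^ 2 / K
        + 4 * C0 * Q * P + 2 * C0 * (g0 ^ 2 + g1 ^ 2) := by
    linarith
  have c6 := mul_le_mul_of_nonneg_left inner_le hεp.le
  have k1 : min lam ε * N ^ 2 ≤ lam * N ^ 2 :=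
    mul_le_mul_of_nonneg_right (min_le_left _ _) (sq_nonneg _)
  have k2 : min lam ε * A ≤ ε * A := mul_le_mul_of_nonneg_right (min_le_right _ _) hA0
  have k3 : min lam ε * (K * B ^ 2) ≤ ε * (K * B ^ 2) :=
    mul_le_mul_of_nonneg_right (min_le_right _ _) (by positivity)
  have d1 : F ^ 2 / lam + ε * (F ^ 2 / K) + (g0 ^ 2 + g1 ^ 2) / c
      + ε * (2 * C0 * (g0 ^ 2 + g1 ^ 2))
      ≤ (1 / lam + ε / K + (1 / c + 2 * ε * C0)) * (F ^ 2 + g0 ^ 2 + g1 ^ 2) := by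
    have e : (1 / lam + ε / K + (1 / c + 2 * ε * C0)) * (F ^ 2 + g0 ^ 2 + g1 ^ 2)
        - (F ^ 2 / lam + ε * (F ^ 2 / K) + (g0 ^ 2 + g1 ^ 2) / c
      + ε * (2 * C0 * (g0 ^ 2 + g1 ^ 2)))
      = (1 / lam + ε / K) * (g0 ^ 2 + g1 ^ 2) + (1 / c + 2 * ε * C0) * F ^ 2 := by ring
    have : 0 ≤ (1 / lam + ε / K) * (g0 ^ 2 + g1 ^ 2) + (1 / c + 2 * ε * C0) * F ^ 2 := by
      positivity
    linarith
  have c7 : 0 ≤ c / 4 * P := by positivity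
  linear_combination b1 + b4 + b5 + b9 + c2 + c3 + c4 + c5 + c6 + k1 / 2 + k2 / 2 + k3 / 2 + d1
    + c7

/-! ### Exponential decay -/

/-- For small `ε` the perturbed energy is equivalent to the energy, which is the case `ε = 0`. -/
theorem perturbedEnergy_mem_bounds {h0 h1 K ε : ℝ} (hh0 : 0 ≤ h0) (hh1 : 0 ≤ h1)
    (hε : 0 ≤ ε) (hε1 : ε ≤ 1 / 2) (hε2 : ε ≤ K / 2) (w : H1) (z : L2) :
    1 / 2 * perturbedEnergy h0 h1 K 0 w z ≤ perturbedEnergy h0 h1 K ε w z ∧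
    perturbedEnergy h0 h1 K ε w z ≤ 3 / 2 * perturbedEnergy h0 h1 K 0 w z := by
  have hi := abs_le.1 (abs_real_inner_le_norm w.toL2 z)
  have hy : ‖w.toL2‖ * ‖z‖ ≤ (‖w.toL2‖ ^ 2 + ‖z‖ ^ 2) / 2 := by
    nlinarith [sq_nonneg (‖w.toL2‖ - ‖z‖)]
  have h1' : ε * inner ℝ w.toL2 z ≤ ε * ((‖w.toL2‖ ^ 2 + ‖z‖ ^ 2) / 2) :=
    mul_le_mul_of_nonneg_left (by linarith) hε
  have h2' : ε * -inner ℝ w.toL2 z ≤ ε * ((‖w.toL2‖ ^ 2 + ‖z‖ ^ 2) / 2) :=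
    mul_le_mul_of_nonneg_left (by linarith) hε
  have h3 : ε * ‖z‖ ^ 2 ≤ 1 / 2 * ‖z‖ ^ 2 := by gcongr
  have h4 : ε * ‖w.toL2‖ ^ 2 ≤ K / 2 * ‖w.toL2‖ ^ 2 := by gcongr
  have h5 : 0 ≤ ‖w.dx‖ ^ 2 + h0 * w.eval 0 ^ 2 + h1 * w.eval 1 ^ 2 := by positivity
  unfold perturbedEnergy
  constructor <;> linarith

/-- A Gronwall inequality for absolutely continuous functions and an exponentially decaying
source. -/
theorem exp_decay_of_ae_deriv_le {G G' : ℝ → ℝ} {γ σ A T : ℝ} (hT : 0 ≤ T) (hγσ : γ < σ)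
    (hA : 0 ≤ A) (hG : AbsolutelyContinuousOnInterval G 0 T)
    (hd : ∀ᵐ t, t ∈ Icc 0 T →
      HasDerivAt G (G' t) t ∧ G' t ≤ -γ * G t + A * Real.exp (-σ * t)) :
    G T ≤ (G 0 + A / (σ - γ)) * Real.exp (-γ * T) := by
  have hσγ : 0 < σ - γ := sub_pos.2 hγσ
  have ac : ∀ r : ℝ, AbsolutelyContinuousOnInterval (fun t => Real.exp (r * t)) 0 T := fun r =>
    (ContDiff.contDiffOn (by fun_prop)).absolutelyContinuousOnInterval
  have hexp : ∀ r t : ℝ, HasDerivAt (fun t => Real.exp (r * t)) (r * Real.exp (r * t)) t := by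
    intro r t
    have := ((hasDerivAt_id t).const_mul r).exp
    simpa [mul_comm] using this
  -- `exp (γ t) G(t) + A / (σ - γ) exp (-(σ - γ) t)` is nonincreasing.
  have key := le_of_absolutelyContinuous_of_deriv_nonpos hT
    (((ac γ).fun_mul hG).fun_add ((ac (-(σ - γ))).const_mul (A / (σ - γ))))
    (f' := fun t => (γ * Real.exp (γ * t) * G t + Real.exp (γ * t) * G' t)
      + A / (σ - γ) * (-(σ - γ) * Real.exp (-(σ - γ) * t))) (by
    filter_upwards [hd] with t ht ht'
    obtain ⟨h1, h2⟩ := ht ht'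
    refine ⟨((hexp γ t).fun_mul h1).fun_add ((hexp _ t).const_mul _), ?_⟩
    have e1 : A / (σ - γ) * (-(σ - γ) * Real.exp (-(σ - γ) * t))
        = -(Real.exp (γ * t) * (A * Real.exp (-σ * t))) := by
      have : Real.exp (-(σ - γ) * t) = Real.exp (γ * t) * Real.exp (-σ * t) := by
        rw [← Real.exp_add]; ring_nf
      rw [this]
      field_simp
    have h3 := mul_le_mul_of_nonneg_left h2 (Real.exp_pos (γ * t)).le
    rw [e1]
    linarith)
  simp only [mul_zero, Real.exp_zero, one_mul, mul_one] at key
  have h1 : 0 ≤ A / (σ - γ) * Real.exp (-(σ - γ) * T) := by positivity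
  have h2 : Real.exp (γ * T) * G T ≤ G 0 + A / (σ - γ) := by linarith
  have h3 := mul_le_mul_of_nonneg_right h2 (Real.exp_pos (-γ * T)).le
  have e : Real.exp (γ * T) * G T * Real.exp (-γ * T) = G T := by
    have : Real.exp (γ * T) * Real.exp (-γ * T) = 1 := by
      rw [← Real.exp_add]; simp
    linear_combination G T * this
  linarith

/-- Decay of the perturbed energy of a strong solution, given the dissipation inequality for its
coefficients. -/
theorem IsStrongSolution.exp_decay {c : Coeffs} {ε κ C : ℝ} (hh0 : 0 ≤ c.h0) (hh1 : 0 ≤ c.h1)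
    (hε : 0 ≤ ε) (hε1 : ε ≤ 1 / 2) (hε2 : ε ≤ c.K / 2) (hκ : 0 ≤ κ) (hC : 0 ≤ C)
    (hdiss : ∀ x y p q N B D F g0 g1 I J L : ℝ,
      |I| ≤ B * N → |J| ≤ N * F → |L| ≤ B * F → y ^ 2 ≤ 2 * x ^ 2 + 2 * D ^ 2 →
      J - c.lam * N ^ 2 - (c.lam0 * p + c.ht1 * y + c.lamt1 * q + g0) * p
        - (c.lam1 * q + c.ht0 * x + c.lamt0 * p + g1) * q
        + ε * (N ^ 2 - (D ^ 2 + c.h0 * x ^ 2 + c.h1 * y ^ 2) - c.K * B ^ 2 - c.lam * I + L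
          - (c.lam0 * p + c.ht1 * y + c.lamt1 * q + g0) * x
          - (c.lam1 * q + c.ht0 * x + c.lamt0 * p + g1) * y)
      ≤ -κ * (1 / 2 * N ^ 2 + 1 / 2 * (D ^ 2 + c.h0 * x ^ 2 + c.h1 * y ^ 2) + c.K / 2 * B ^ 2)
        + C * (F ^ 2 + g0 ^ 2 + g1 ^ 2))
    {f : ℝ → L2} {g0 g1 : ℝ → ℝ} {u0 : H1} {u1 : L2} {u : ℝ → H1}
    (hu : IsStrongSolution c f g0 g1 u0 u1 u) {γ σ₁ σ₂ : ℝ} (hγ : γ ≤ 2 / 3 * κ)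
    (hγσ : γ < σ₂) (hσ₁ : 0 ≤ σ₁)
    (hdata : ∀ t : ℝ, 0 ≤ t → ‖f t‖ ^ 2 + g0 t ^ 2 + g1 t ^ 2 ≤ σ₁ * Real.exp (-σ₂ * t))
    {T : ℝ} (hT : 0 < T) :
    perturbedEnergy c.h0 c.h1 c.K ε (u T) (timeDeriv u T)
      ≤ (perturbedEnergy c.h0 c.h1 c.K ε (u 0) (timeDeriv u 0) + C * σ₁ / (σ₂ - γ))
        * Real.exp (-γ * T) := by
  obtain ⟨U, V, W, hU, hV, hW, hUu, hVu, hWu, heq, hb0, hb1⟩ := hu.equations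
  obtain ⟨acu, du⟩ := absolutelyContinuous_and_ae_hasDerivAt hT (hV.intervalIntegrable hT)
    (eq_add_integral_of_toL2_eq_timeDeriv hu.contDiffOn hV hVu hT)
  obtain ⟨acv, dv⟩ := absolutelyContinuous_and_ae_hasDerivAt hT (hW.intervalIntegrable hT)
    (timeDeriv_eq_add_integral hu.contDiffOn hW hT (hWu T hT))
  refine exp_decay_of_ae_deriv_le hT.le hγσ (mul_nonneg hC hσ₁)
    (absolutelyContinuous_perturbedEnergy c.h0 c.h1 c.K ε acu acv)
    (G' := fun t => inner ℝ (timeDeriv u t) (W t) + (inner ℝ (u t).dx (V t).dx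
        + c.h0 * ((u t).eval 0 * (V t).eval 0)
        + c.h1 * ((u t).eval 1 * (V t).eval 1)) + c.K * inner ℝ (u t).toL2 (V t).toL2
        + ε * (inner ℝ (u t).toL2 (W t) + inner ℝ (V t).toL2 (timeDeriv u t))) ?_
  rw [ae_restrict_iff' measurableSet_Ioi] at hUu hVu heq hb0 hb1
  filter_upwards [du, dv, hUu, hVu, heq, hb0, hb1, Measure.ae_ne volume 0]
    with t h1 h2 h3 h4 h5 h6 h7 h8 ht
  have ht0 : t ∈ Ioi (0 : ℝ) := lt_of_le_of_ne ht.1 (Ne.symm h8)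
  refine ⟨hasDerivAt_perturbedEnergy _ _ _ _ (h1 ht) (h2 ht), ?_⟩
  rw [perturbedEnergy_deriv_eq ε (h3 ht0) (h4 ht0) (h5 ht0) (h6 ht0) (h7 ht0)]
  have hd := hdiss ((u t).eval 0) ((u t).eval 1) ((V t).eval 0) ((V t).eval 1) ‖timeDeriv u t‖
    ‖(u t).toL2‖ ‖(u t).dx‖ ‖f t‖ (g0 t) (g1 t) (inner ℝ (u t).toL2 (timeDeriv u t))
    (inner ℝ (timeDeriv u t) (f t)) (inner ℝ (u t).toL2 (f t))
    (abs_real_inner_le_norm _ _) (abs_real_inner_le_norm _ _) (abs_real_inner_le_norm _ _)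
    (u t).eval_one_sq_le
  refine hd.trans ?_
  obtain ⟨k1, k2⟩ := perturbedEnergy_mem_bounds hh0 hh1 hε hε1 hε2 (u t) (timeDeriv u t)
  have k3 : 1 / 2 * ‖timeDeriv u t‖ ^ 2
      + 1 / 2 * (‖(u t).dx‖ ^ 2 + c.h0 * (u t).eval 0 ^ 2 + c.h1 * (u t).eval 1 ^ 2)
      + c.K / 2 * ‖(u t).toL2‖ ^ 2 = perturbedEnergy c.h0 c.h1 c.K 0 (u t) (timeDeriv u t) := by
    rw [perturbedEnergy, zero_mul, add_zero]
  have hE : 0 ≤ perturbedEnergy c.h0 c.h1 c.K ε (u t) (timeDeriv u t) := by linarith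
  rw [k3]
  have k4 := mul_le_mul_of_nonneg_left (hdata t ht.1) hC
  have k5 := mul_le_mul_of_nonneg_left k2 hκ
  have k6 := mul_le_mul_of_nonneg_right hγ hE
  linarith

end WaveDecay

end

theorem theorem5p4 (h0 h1 lam0 lam1 lamt0 lamt1 K lam : ℝ)
    (hh0 : 0 < h0) (hh1 : 0 ≤ h1) (hlam0 : 0 < lam0) (hlam1 : 0 < lam1)
    (hlamt : |lamt0 + lamt1| < 2 * Real.sqrt (lam0 * lam1))
    (hK : 0 < K) (hlam : 0 < lam) :
    ∃ η : ℝ, 0 < η ∧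
      ∀ ht0 ht1 : ℝ, |ht0| ≤ η → |ht1| ≤ η →
      ∀ σ₂ : ℝ, 0 < σ₂ →
      ∃ γ₂ : ℝ, 0 < γ₂ ∧
        ∀ σ₁ : ℝ, 0 < σ₁ → ∀ M : ℝ,
        ∃ γ₁ : ℝ, 0 < γ₁ ∧
          ∀ (f : ℝ → WaveDecay.L2) (g0 g1 : ℝ → ℝ) (u0 : WaveDecay.H1) (u1 : WaveDecay.L2)
            (u : ℝ → WaveDecay.H1),
            (∀ t : ℝ, 0 ≤ t → ‖f t‖ ^ 2 + g0 t ^ 2 + g1 t ^ 2 ≤ σ₁ * Real.exp (-σ₂ * t)) →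
            WaveDecay.IsStrongSolution
              { h0 := h0, h1 := h1, lam0 := lam0, lam1 := lam1, ht0 := ht0, ht1 := ht1,
                lamt0 := lamt0, lamt1 := lamt1, K := K, lam := lam } f g0 g1 u0 u1 u →
            WaveDecay.energy h0 h1 K u 0 ≤ M →
            ∀ t : ℝ, 0 ≤ t →
              WaveDecay.energy h0 h1 K u t ≤ γ₁ * Real.exp (-γ₂ * t) := by
  obtain ⟨ε, η, κ, C, hε, hη, hκ, hC, hε1, hε2, hdiss⟩ :=
    WaveDecay.exists_dissipation hh0 hh1 hlam0 hlam1 hlamt hK hlam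
  refine ⟨η, hη, fun ht0 ht1 hht0 hht1 σ₂ hσ₂ => ?_⟩
  -- A rate strictly below `σ₂` keeps the convolution of the two exponentials free of a factor `t`.
  obtain ⟨γ, hγ⟩ : ∃ γ, γ = min (2 / 3 * κ) (σ₂ / 2) := ⟨_, rfl⟩
  have hγp : 0 < γ := by rw [hγ]; positivity
  have hγ1 : γ ≤ 2 / 3 * κ := by rw [hγ]; exact min_le_left _ _
  have hγ2 : γ < σ₂ := by
    have : γ ≤ σ₂ / 2 := by rw [hγ]; exact min_le_right _ _
    linarith
  have hσγ : 0 < σ₂ - γ := sub_pos.2 hγ2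
  refine ⟨γ, hγp, fun σ₁ hσ₁ M => ⟨3 * |M| + 2 * (C * σ₁ / (σ₂ - γ)), by positivity, ?_⟩⟩
  intro f g0 g1 u0 u1 u hdata hu hM t ht
  have hpos : 0 < C * σ₁ / (σ₂ - γ) := by positivity
  rcases ht.eq_or_lt with rfl | htp
  · rw [mul_zero, Real.exp_zero, mul_one]
    linarith [le_abs_self M, abs_nonneg M]
  have key := hu.exp_decay hh0.le hh1 hε.le hε1 hε2 hκ.le hC.le
    (hdiss ht0 ht1 hht0 hht1) hγ1 hγ2 hσ₁.le hdata htp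
  dsimp only at key
  have k1 := (WaveDecay.perturbedEnergy_mem_bounds hh0.le hh1 hε.le hε1 hε2 (u t)
    (WaveDecay.timeDeriv u t)).1
  have k2 := (WaveDecay.perturbedEnergy_mem_bounds hh0.le hh1 hε.le hε1 hε2 (u 0)
    (WaveDecay.timeDeriv u 0)).2
  rw [WaveDecay.energy_eq_perturbedEnergy hh0.le hh1] at hM ⊢
  have k3 : 2 * ((WaveDecay.perturbedEnergy h0 h1 K ε (u 0) (WaveDecay.timeDeriv u 0)
      + C * σ₁ / (σ₂ - γ)) * Real.exp (-γ * t)) ≤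
      (3 * |M| + 2 * (C * σ₁ / (σ₂ - γ))) * Real.exp (-γ * t) := by
    rw [← mul_assoc]
    refine mul_le_mul_of_nonneg_right ?_ (Real.exp_pos _).le
    linarith [le_abs_self M]
  linarith
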